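/- Let $\Gamma\subset\mathbf Q^*$ be a finitely generated subgroup, of rank $r\ge 0$. Let $$\Gamma_\infty=\{x\in\mathbf C^*: x^n\in\Gamma\text{ for some integer } n\ge1\},\qquad \Gamma_0^+=\Gamma_\infty\cap\mathbf Q_{>0},$$ let $\mu_\infty\subset\Gamma_\infty$ be the group of all roots of unity in $\mathbf C^*$ and $\mu_2=\{\pm1\}$, and let $A=\mathrm{Aut}_{\Gamma_\infty\cap\mathbf Q^*}(\Gamma_\infty)$ be the group of automorphisms of the abelian group $\Gamma_\infty$ that are the identity on $\Gamma_\infty\cap\mathbf Q^*$. Let $G=\mathrm{Gal}(\mathbf Q(\Gamma_\infty)/\mathbf Q)$, and consider the homomorphism $G\to A$ that describes the action of $G$ on $\Gamma_\infty$. For $b\in\Gamma_0^+$, let $b^{1/2}$ be its positive square root, which lies in both $\Gamma_\infty$ and $\mathbf Q(\mu_\infty)$, and define the quadratic character $\chi_{[b]}:A\to\mu_2$ by $$\chi_{[b]}(\alpha)=\frac{\alpha(b^{1/2})}{b^{1/2}}\cdot\frac{\sigma_\alpha(b^{1/2})}{b^{1/2}},$$ where $\sigma_\alpha\in\mathrm{Gal}(\mathbf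 Q(\mu_\infty)/\mathbf Q)$ is the unique field automorphism that coincides with $\alpha$ on $\mu_\infty$ (under the isomorphism $\mathrm{Gal}(\mathbf Q(\mu_\infty)/\mathbf Q)\cong\mathrm{Aut}(\mu_\infty)$ given by the Galois action). Then $G\to A$ is injective, its image (again denoted $G$) is a normal subgroup of $A$ of index $2^r$, the groups $A/G$ and $\Gamma_0^+/(\Gamma_0^+)^2$ are elementary abelian $2$-groups, and $$A/G\times\Gamma_0^+/(\Gamma_0^+)^2\longrightarrow\mu_2,\qquad(\alpha,b)\longmapsto\chi_{[b]}(\alpha)$$ is a well-defined perfect pairing: it is bimultiplicative, and the induced homomorphisms $A/G\to\mathrm{Hom}(\Gamma_0^+/(\Gamma_0^+)^2,\mu_2)$ and $\Gamma_0^+/(\Gamma_0^+)^2\to\mathrm{Hom}(A/G,\mu_2)$ are isomorphisms. -/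

import Mathlib

open scoped IntermediateField

noncomputable section

namespace RadicalExt

/-! ### The action of a Galois group on a group of generators -/

/-- For a subgroup `H` of `ℂ*`, the field `ℚ(H) ⊆ ℂ` obtained by adjoining `H` to `ℚ`. -/
def adjoinGroup (H : Subgroup ℂˣ) : IntermediateField ℚ ℂ :=
  IntermediateField.adjoin ℚ ((fun u : ℂˣ => (u : ℂ)) '' (H : Set ℂˣ))

theorem coe_mem_adjoinGroup {H : Subgroup ℂˣ} {u : ℂˣ} (hu : u ∈ H) :
    (u : ℂ) ∈ adjoinGroup H :=
  IntermediateField.subset_adjoin ℚ _ ⟨u, hu, rfl⟩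

/-- An element of `H` as an element of the field `ℚ(H)`. -/
def gen {H : Subgroup ℂˣ} (u : H) : adjoinGroup H := ⟨((u : ℂˣ) : ℂ), coe_mem_adjoinGroup u.2⟩

/-- The subgroup `H` of `ℂ*` is stable under the Galois action on `ℚ(H)`. -/
def GalStable (H : Subgroup ℂˣ) : Prop :=
  ∀ (g : Gal(adjoinGroup H/ℚ)) (u : H), ∃ v : H, gen v = g (gen u)

theorem gen_injective {H : Subgroup ℂˣ} : Function.Injective (gen (H := H)) := by
  intro u v h
  have : ((u : ℂˣ) : ℂ) = ((v : ℂˣ) : ℂ) := congrArg Subtype.val h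
  exact Subtype.ext (Units.ext this)

theorem gen_mul {H : Subgroup ℂˣ} (u v : H) : gen (u * v) = gen u * gen v := by
  apply Subtype.ext; simp [gen]

theorem gen_one {H : Subgroup ℂˣ} : gen (1 : H) = 1 := by
  apply Subtype.ext; simp [gen]

theorem gen_pow {H : Subgroup ℂˣ} (u : H) (n : ℕ) : gen (u ^ n) = gen u ^ n := by
  apply Subtype.ext; simp [gen]

/-- The image `v` of `u : H` under a field automorphism `g` of `ℚ(H)`. -/
def galSMul {H : Subgroup ℂˣ} (hH : GalStable H) (g : Gal(adjoinGroup H/ℚ)) (u : H) : H :=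
  (hH g u).choose

theorem gen_galSMul {H : Subgroup ℂˣ} (hH : GalStable H) (g : Gal(adjoinGroup H/ℚ)) (u : H) :
    gen (galSMul hH g u) = g (gen u) := (hH g u).choose_spec

/-- The action of `Gal(ℚ(H)/ℚ)` on `H` by group automorphisms. -/
def galAction {H : Subgroup ℂˣ} (hH : GalStable H) : Gal(adjoinGroup H/ℚ) →* MulAut H where
  toFun g :=
    { toFun := galSMul hH g
      invFun := galSMul hH g⁻¹
      left_inv := fun u => gen_injective (by
        simp only [gen_galSMul]; rw [← AlgEquiv.mul_apply]; simp)
      right_inv := fun u => gen_injective (by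
        simp only [gen_galSMul]; rw [← AlgEquiv.mul_apply]; simp)
      map_mul' := fun u v => gen_injective (by simp only [gen_galSMul, gen_mul, map_mul]) }
  map_one' := by
    ext1 u
    exact gen_injective (by simp [gen_galSMul])
  map_mul' g h := by
    ext1 u
    exact gen_injective (by simp [gen_galSMul])

theorem gen_galAction {H : Subgroup ℂˣ} (hH : GalStable H) (g : Gal(adjoinGroup H/ℚ)) (u : H) :
    gen (galAction hH g u) = g (gen u) := gen_galSMul hH g u

theorem galAction_injective {H : Subgroup ℂˣ} (hH : GalStable H) :
    Function.Injective (galAction hH) := by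
  intro g h hgh
  have key : (g : adjoinGroup H →ₐ[ℚ] adjoinGroup H) = h := by
    refine IntermediateField.algHom_ext_of_eq_adjoin (S := adjoinGroup H) _ rfl ?_
    rintro _ ⟨u, hu, rfl⟩
    have := congrArg (fun s => gen (s ⟨u, hu⟩)) hgh
    simp only [gen_galAction] at this
    exact this
  ext1 x
  exact DFunLike.congr_fun key x

/-! ### Roots of unity and the cyclotomic field -/

/-- The group `μ_∞` of all complex roots of unity. -/
def muInf : Subgroup ℂˣ := CommGroup.torsion ℂˣ

theorem mem_muInf {u : ℂˣ} : u ∈ muInf ↔ ∃ n : ℕ, 0 < n ∧ u ^ n = 1 :=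
  isOfFinOrder_iff_pow_eq_one

/-- The maximal cyclotomic field `ℚ(μ_∞)`. -/
abbrev cycField : IntermediateField ℚ ℂ := adjoinGroup muInf

theorem galStable_muInf : GalStable muInf := by
  intro g u
  obtain ⟨n, hn, hu⟩ := mem_muInf.1 u.2
  have h1 : (g (gen u)) ^ n = 1 := by
    rw [← map_pow, ← gen_pow, show u ^ n = 1 from Subtype.ext hu, gen_one, map_one]
  have h2 : ((g (gen u) : cycField) : ℂ) ^ n = 1 := by
    have := congrArg Subtype.val h1
    simpa using this
  exact ⟨⟨Units.ofPowEqOne _ n h2 hn.ne', mem_muInf.2 ⟨n, hn, Units.ext (by simp)⟩⟩,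
    Subtype.ext (by simp [gen])⟩

theorem isAlgebraic_of_mem_muInf {u : ℂˣ} (hu : u ∈ muInf) : IsAlgebraic ℚ (u : ℂ) := by
  obtain ⟨n, hn, hu⟩ := mem_muInf.1 hu
  have : IsIntegral ℚ ((u : ℂ) ^ n) := by
    rw [← Units.val_pow_eq_pow_val, hu]; exact isIntegral_one
  exact (this.of_pow hn).isAlgebraic

instance : Algebra.IsAlgebraic ℚ cycField := by
  apply IntermediateField.isAlgebraic_adjoin
  rintro _ ⟨u, hu, rfl⟩
  exact (isAlgebraic_of_mem_muInf hu).isIntegral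

theorem mem_cycField_iff (z : ℂ) : z ∈ cycField ↔
    z ∈ Algebra.adjoin ℚ ((fun u : ℂˣ => (u : ℂ)) '' (muInf : Set ℂˣ)) := by
  rw [← IntermediateField.adjoin_toSubalgebra_of_isAlgebraic]
  · rfl
  · rintro _ ⟨u, hu, rfl⟩
    exact isAlgebraic_of_mem_muInf hu

/-- The elements of `μ_∞` as elements of its field, as a homomorphism. -/
def genHom : muInf →* cycField where
  toFun := gen
  map_one' := gen_one
  map_mul' := gen_mul

theorem genHom_pow_order {u : muInf} {n : ℕ} (hu : orderOf u = n) :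
    IsPrimitiveRoot ((u : ℂˣ) : ℂ) n := by
  rw [IsPrimitiveRoot.coe_units_iff, IsPrimitiveRoot.coe_submonoidClass_iff, ← hu]
  exact IsPrimitiveRoot.orderOf u

theorem exists_orderOf (n : ℕ) (hn : 0 < n) : ∃ u : muInf, orderOf u = n := by
  have h := Complex.isPrimitiveRoot_exp n hn.ne'
  have h' := h.isUnit_unit hn.ne'
  refine ⟨⟨(h.isUnit hn.ne').unit, mem_muInf.2 ⟨n, hn, h'.pow_eq_one⟩⟩, ?_⟩
  rw [← Subgroup.orderOf_coe]
  exact h'.eq_orderOf.symm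

/-- Every rational combination of roots of unity is a polynomial in one root of unity, in a way
compatible with a given automorphism of `μ_∞`. -/
theorem exists_poly (s : MulAut muInf) (x : MonoidAlgebra ℚ muInf) :
    ∃ N : ℕ, 0 < N ∧ ∀ M : ℕ, N ∣ M → 0 < M → ∀ u : muInf, orderOf u = M →
      ∃ f : Polynomial ℚ,
        MonoidAlgebra.lift ℚ cycField muInf genHom x = Polynomial.aeval (gen u) f ∧
        MonoidAlgebra.lift ℚ cycField muInf (genHom.comp s.toMonoidHom) x =
          Polynomial.aeval (gen (s u)) f := by
  induction x using MonoidAlgebra.induction_on with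
  | of m =>
    obtain ⟨n, hn, hm⟩ := mem_muInf.1 m.2
    refine ⟨n, hn, fun M hM hM0 u hu => ?_⟩
    have hu' := genHom_pow_order hu
    have : NeZero M := ⟨hM0.ne'⟩
    have hm1 : (((m : ℂˣ) : ℂ)) ^ M = 1 := by
      obtain ⟨k, rfl⟩ := hM
      rw [pow_mul, ← Units.val_pow_eq_pow_val, hm]; simp
    obtain ⟨i, -, hi⟩ := hu'.eq_pow_of_pow_eq_one hm1
    have hmu : m = u ^ i := Subtype.ext (Units.ext (by simpa using hi.symm))
    refine ⟨Polynomial.X ^ i, ?_, ?_⟩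
    · rw [MonoidAlgebra.lift_of]; simp [hmu, genHom, gen_pow]
    · rw [MonoidAlgebra.lift_of]; simp [hmu, genHom, gen_pow]
  | add x y hx hy =>
    obtain ⟨N, hN, hx⟩ := hx
    obtain ⟨N', hN', hy⟩ := hy
    refine ⟨N * N', Nat.mul_pos hN hN', fun M hM hM0 u hu => ?_⟩
    obtain ⟨f, hf, hf'⟩ := hx M (dvd_trans (dvd_mul_right _ _) hM) hM0 u hu
    obtain ⟨g, hg, hg'⟩ := hy M (dvd_trans (dvd_mul_left _ _) hM) hM0 u hu
    exact ⟨f + g, by rw [map_add, map_add, hf, hg], by rw [map_add, map_add, hf', hg']⟩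
  | smul r x hx =>
    obtain ⟨N, hN, hx⟩ := hx
    refine ⟨N, hN, fun M hM hM0 u hu => ?_⟩
    obtain ⟨f, hf, hf'⟩ := hx M hM hM0 u hu
    exact ⟨r • f, by rw [map_smul, map_smul, hf], by rw [map_smul, map_smul, hf']⟩

theorem aeval_gen_eq_zero {u v : muInf} (huv : orderOf v = orderOf u) {f : Polynomial ℚ}
    (hf : Polynomial.aeval (gen u) f = 0) : Polynomial.aeval (gen v) f = 0 := by
  have hpos : 0 < orderOf u := by
    obtain ⟨n, hn, hm⟩ := mem_muInf.1 u.2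
    exact orderOf_pos_iff.2 (isOfFinOrder_iff_pow_eq_one.2 ⟨n, hn, Subtype.ext hm⟩)
  have key : ∀ w : muInf, orderOf w = orderOf u →
      minpoly ℚ (gen w) = Polynomial.cyclotomic (orderOf u) ℚ := by
    intro w hw
    have h : IsPrimitiveRoot (gen w) (orderOf u) := by
      have := genHom_pow_order hw
      exact IsPrimitiveRoot.of_map_of_injective (f := cycField.val) this
        (cycField.val : cycField →+* ℂ).injective
    exact (Polynomial.cyclotomic_eq_minpoly_rat h hpos).symm
  rw [← minpoly.dvd_iff] at hf ⊢
  rwa [key v huv, ← key u rfl]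

theorem lift_genHom_surjective :
    Function.Surjective (MonoidAlgebra.lift ℚ cycField muInf genHom) := by
  rintro ⟨z, hz⟩
  have hz' := (mem_cycField_iff z).1 hz
  have : Algebra.adjoin ℚ ((fun u : ℂˣ => (u : ℂ)) '' (muInf : Set ℂˣ)) ≤
      (cycField.val.comp (MonoidAlgebra.lift ℚ cycField muInf genHom)).range := by
    apply Algebra.adjoin_le
    rintro _ ⟨u, hu, rfl⟩
    refine ⟨MonoidAlgebra.of ℚ muInf ⟨u, hu⟩, ?_⟩
    change ((MonoidAlgebra.lift ℚ cycField muInf genHom (MonoidAlgebra.of ℚ muInf ⟨u, hu⟩) :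
      cycField) : ℂ) = u
    rw [MonoidAlgebra.lift_of]
    rfl
  obtain ⟨x, hx⟩ := this hz'
  exact ⟨x, Subtype.ext hx⟩

theorem galAction_muInf_surjective : Function.Surjective (galAction galStable_muInf) := by
  intro s
  have hker : RingHom.ker (MonoidAlgebra.lift ℚ cycField muInf genHom) ≤
      RingHom.ker (MonoidAlgebra.lift ℚ cycField muInf (genHom.comp s.toMonoidHom)) := by
    intro x hx
    rw [RingHom.mem_ker] at hx ⊢
    obtain ⟨N, hN, h⟩ := exists_poly s x
    obtain ⟨u, hu⟩ := exists_orderOf N hN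
    obtain ⟨f, hf, hf'⟩ := h N dvd_rfl hN u hu
    rw [hf']
    exact aeval_gen_eq_zero (MulEquiv.orderOf_eq s u) (hf ▸ hx)
  let t : cycField →ₐ[ℚ] cycField := AlgHom.liftOfSurjective _ lift_genHom_surjective _ hker
  have ht : ∀ u : muInf, t (gen u) = gen (s u) := by
    intro u
    have h1 : gen u = MonoidAlgebra.lift ℚ cycField muInf genHom (MonoidAlgebra.of ℚ muInf u) := by
      rw [MonoidAlgebra.lift_of]; rfl
    have h2 : gen (s u) = MonoidAlgebra.lift ℚ cycField muInf (genHom.comp s.toMonoidHom)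
        (MonoidAlgebra.of ℚ muInf u) := by
      rw [MonoidAlgebra.lift_of]; rfl
    rw [h1, h2]
    exact AlgHom.liftOfSurjective_apply _ _ _ _ _
  refine ⟨AlgEquiv.ofBijective t (Algebra.IsAlgebraic.algHom_bijective t), ?_⟩
  ext1 u
  apply gen_injective
  rw [gen_galAction, ← ht]
  rfl

/-- The familiar isomorphism `Gal(ℚ(μ_∞)/ℚ) ≃ Aut(μ_∞)` given by the Galois action on `μ_∞`. -/
def cycEquiv : Gal(cycField/ℚ) ≃* MulAut muInf :=
  MulEquiv.ofBijective (galAction galStable_muInf)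
    ⟨galAction_injective galStable_muInf, galAction_muInf_surjective⟩

/-! ### Square roots of positive rational numbers are cyclotomic -/

theorem mem_cycField_of_pow_eq_one {z : ℂ} {n : ℕ} (hn : 0 < n) (hz : z ^ n = 1) :
    z ∈ cycField :=
  coe_mem_adjoinGroup (u := Units.ofPowEqOne z n hz hn.ne')
    (mem_muInf.2 ⟨n, hn, Units.ext (by simp)⟩)

theorem mem_cycField_of_sq_eq {x y : ℂ} (hy : y ∈ cycField) (h : x ^ 2 = y ^ 2) :
    x ∈ cycField := by
  rcases sq_eq_sq_iff_eq_or_eq_neg.1 h with rfl | rfl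
  · exact hy
  · exact neg_mem hy

theorem I_mem_cycField : Complex.I ∈ cycField :=
  mem_cycField_of_pow_eq_one (n := 4) (by norm_num) (by simp)

theorem sqrt_two_mem_cycField {x : ℂ} (hx : x ^ 2 = 2) : x ∈ cycField := by
  have h : x * (1 + Complex.I) / 2 ∈ cycField := by
    apply mem_cycField_of_pow_eq_one (n := 8) (by norm_num)
    have h2 : (1 + Complex.I) ^ 2 = 2 * Complex.I := by
      linear_combination Complex.I_sq
    calc (x * (1 + Complex.I) / 2) ^ 8 = (x ^ 2) ^ 4 * ((1 + Complex.I) ^ 2) ^ 4 / 2 ^ 8 := by ring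
      _ = 1 := by
        rw [hx, h2, mul_pow, Complex.I_pow_four]; norm_num
  have h1 : (1 + Complex.I) ≠ 0 := by
    intro h0
    have := congrArg Complex.re h0
    simp at this
  have : x = x * (1 + Complex.I) / 2 * 2 / (1 + Complex.I) := by field_simp
  rw [this]
  exact div_mem (mul_mem h (ofNat_mem cycField 2)) (add_mem (one_mem _) I_mem_cycField)

theorem sqrt_prime_mem_cycField {p : ℕ} (hp : p.Prime) {x : ℂ} (hx : x ^ 2 = p) :
    x ∈ cycField := by
  rcases eq_or_ne p 2 with rfl | hp2
  · exact sqrt_two_mem_cycField (by simpa using hx)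
  have : Fact p.Prime := ⟨hp⟩
  let c : MulChar (ZMod p) ℂ := (quadraticChar (ZMod p)).ringHomComp (Int.castRingHom ℂ)
  have hc1 : c ≠ 1 := by
    rw [MulChar.ringHomComp_ne_one_iff (Int.castRingHom ℂ).injective_int]
    exact quadraticChar_ne_one (by rwa [ZMod.ringChar_zmod_n])
  have hc2 : c.IsQuadratic := (quadraticChar_isQuadratic (ZMod p)).comp _
  have hg := gaussSum_sq hc1 hc2 (ZMod.isPrimitive_stdAddChar p)
  rw [ZMod.card] at hg
  have hmem : gaussSum c (ZMod.stdAddChar (N := p)) ∈ cycField := by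
    apply sum_mem
    intro a _
    refine mul_mem (intCast_mem cycField (quadraticChar (ZMod p) a))
      (mem_cycField_of_pow_eq_one hp.pos ?_)
    rw [← AddChar.map_nsmul_eq_pow]
    simp
  rcases hc2 (-1) with h | h | h
  · exfalso
    have hu : IsUnit (-1 : ZMod p) := isUnit_one.neg
    exact (hu.map c).ne_zero h
  · exact mem_cycField_of_sq_eq hmem (by rw [hg, h, hx, one_mul])
  · exact mem_cycField_of_sq_eq (mul_mem I_mem_cycField hmem)
      (by rw [mul_pow, hg, h, hx, Complex.I_sq]; ring)

theorem sqrt_nat_mem_cycField (n : ℕ) : ((√(n : ℝ) : ℝ) : ℂ) ∈ cycField := by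
  induction n using Nat.recOnMul with
  | zero => simp
  | one => simp
  | prime p hp =>
    refine sqrt_prime_mem_cycField hp ?_
    rw [← Complex.ofReal_pow, Real.sq_sqrt (Nat.cast_nonneg p)]
    simp
  | mul a b ha hb =>
    rw [Nat.cast_mul, Real.sqrt_mul (Nat.cast_nonneg a), Complex.ofReal_mul]
    exact mul_mem ha hb

theorem sqrt_rat_mem_cycField {q : ℚ} (hq : 0 < q) : ((√(q : ℝ) : ℝ) : ℂ) ∈ cycField := by
  have h : (q : ℝ) = (q.num.toNat : ℝ) / (q.den : ℝ) := by
    have h1 : ((q.num.toNat : ℤ) : ℝ) = (q.num : ℝ) := by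
      rw [Int.toNat_of_nonneg (Rat.num_nonneg.2 hq.le)]
    rw [← Int.cast_natCast, h1]
    exact Rat.cast_def q
  rw [h, Real.sqrt_div (Nat.cast_nonneg _), Complex.ofReal_div]
  exact div_mem (sqrt_nat_mem_cycField _) (sqrt_nat_mem_cycField _)

/-! ### The radical group of a group of rational numbers -/

/-- The inclusion `ℚ* → ℂ*`. -/
def ratUnit : ℚˣ →* ℂˣ := Units.map (algebraMap ℚ ℂ : ℚ →* ℂ)

/-- The group `Γ_∞` of all complex roots, of arbitrary order, of the elements of `Γ`. -/
def radicalGroup (Γ : Subgroup ℚˣ) : Subgroup ℂˣ where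
  carrier := {x | ∃ n : ℕ, 0 < n ∧ ∃ q ∈ Γ, x ^ n = ratUnit q}
  one_mem' := ⟨1, one_pos, 1, one_mem Γ, by simp⟩
  mul_mem' := by
    rintro x y ⟨n, hn, q, hq, hx⟩ ⟨m, hm, t, ht, hy⟩
    refine ⟨n * m, Nat.mul_pos hn hm, q ^ m * t ^ n, mul_mem (pow_mem hq m) (pow_mem ht n), ?_⟩
    rw [mul_pow, pow_mul, hx, mul_comm n m, pow_mul, hy, map_mul, map_pow, map_pow]
  inv_mem' := by
    rintro x ⟨n, hn, q, hq, hx⟩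
    exact ⟨n, hn, q⁻¹, inv_mem hq, by rw [inv_pow, hx, map_inv]⟩

theorem muInf_le_radicalGroup (Γ : Subgroup ℚˣ) : muInf ≤ radicalGroup Γ := by
  intro u hu
  obtain ⟨n, hn, h⟩ := mem_muInf.1 hu
  exact ⟨n, hn, 1, one_mem Γ, by rw [h, map_one]⟩

theorem galStable_radicalGroup (Γ : Subgroup ℚˣ) : GalStable (radicalGroup Γ) := by
  intro g u
  obtain ⟨n, hn, q, hq, hu⟩ := u.2
  have h0 : gen u ^ n = algebraMap ℚ _ (q : ℚ) := by
    rw [← gen_pow]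
    exact Subtype.ext (congrArg Units.val hu)
  have h1 : g (gen u) ^ n = algebraMap ℚ _ (q : ℚ) := by
    rw [← map_pow, h0, AlgEquiv.commutes]
  have h2 : ((g (gen u) : adjoinGroup (radicalGroup Γ)) : ℂ) ^ n = ((ratUnit q : ℂˣ) : ℂ) :=
    congrArg Subtype.val h1
  have h3 : ((g (gen u) : adjoinGroup (radicalGroup Γ)) : ℂ) ≠ 0 := by
    intro h
    rw [h, zero_pow hn.ne'] at h2
    exact (ratUnit q).ne_zero h2.symm
  exact ⟨⟨Units.mk0 _ h3, n, hn, q, hq, Units.ext (by simpa using h2)⟩, rfl⟩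

/-- The group `A = Aut_{Γ_∞ ∩ ℚ*}(Γ_∞)` of group automorphisms of `Γ_∞` that are the identity on
the rational elements of `Γ_∞`. -/
def radicalAut (Γ : Subgroup ℚˣ) : Subgroup (MulAut (radicalGroup Γ)) where
  carrier := {α | ∀ x : radicalGroup Γ, (∃ q : ℚˣ, ratUnit q = x) → α x = x}
  one_mem' := fun _ _ => rfl
  mul_mem' := by
    intro α β hα hβ x hx
    rw [MulAut.mul_apply, hβ x hx, hα x hx]
  inv_mem' := by
    intro α hα x hx
    rw [MulAut.inv_apply, MulEquiv.symm_apply_eq, hα x hx]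

/-- The Galois representation `G = Gal(ℚ(Γ_∞)/ℚ) → A`: the action of `G` on the radicals. -/
def galRep (Γ : Subgroup ℚˣ) : Gal(adjoinGroup (radicalGroup Γ)/ℚ) →* radicalAut Γ :=
  (galAction (galStable_radicalGroup Γ)).codRestrict (radicalAut Γ) (by
    rintro g x ⟨q, hq⟩
    apply gen_injective
    have h : gen x = algebraMap ℚ _ (q : ℚ) := Subtype.ext (congrArg Units.val hq).symm
    rw [gen_galAction, h, AlgEquiv.commutes])

/-- The group `Γ₀⁺ = Γ_∞ ∩ ℚ_{>0}`. -/
def gammaZeroPlus (Γ : Subgroup ℚˣ) : Subgroup ℚˣ :=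
  (radicalGroup Γ).comap ratUnit ⊓ Units.posSubgroup ℚ

/-! ### The quadratic characters -/

section Characters

variable {Γ : Subgroup ℚˣ}

theorem gammaZeroPlus_pos (b : gammaZeroPlus Γ) : (0 : ℚ) < ((b : ℚˣ) : ℚ) :=
  (Units.mem_posSubgroup _).1 b.2.2

theorem sqrt_ne_zero (b : gammaZeroPlus Γ) :
    ((√((((b : ℚˣ) : ℚ) : ℝ)) : ℝ) : ℂ) ≠ 0 := by
  have : (0 : ℝ) < (((b : ℚˣ) : ℚ) : ℝ) := by exact_mod_cast gammaZeroPlus_pos b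
  exact_mod_cast (Real.sqrt_pos.2 this).ne'

/-- The positive real square root `b^{1/2}` of `b ∈ Γ₀⁺`, as an element of `ℂ*`. -/
def sqrtUnit (b : gammaZeroPlus Γ) : ℂˣ :=
  Units.mk0 ((√((((b : ℚˣ) : ℚ) : ℝ)) : ℝ) : ℂ) (sqrt_ne_zero b)

theorem sqrtUnit_sq (b : gammaZeroPlus Γ) : sqrtUnit b ^ 2 = ratUnit b := by
  have : (0 : ℝ) < (((b : ℚˣ) : ℚ) : ℝ) := by exact_mod_cast gammaZeroPlus_pos b
  apply Units.ext
  change ((√((((b : ℚˣ) : ℚ) : ℝ)) : ℝ) : ℂ) ^ 2 = algebraMap ℚ ℂ ((b : ℚˣ) : ℚ)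
  rw [← Complex.ofReal_pow, Real.sq_sqrt this.le]
  simp

theorem sqrtUnit_mul (b c : gammaZeroPlus Γ) : sqrtUnit (b * c) = sqrtUnit b * sqrtUnit c := by
  have : (0 : ℝ) < (((b : ℚˣ) : ℚ) : ℝ) := by exact_mod_cast gammaZeroPlus_pos b
  apply Units.ext
  simp [sqrtUnit, Real.sqrt_mul this.le]

theorem sqrtUnit_one : sqrtUnit (1 : gammaZeroPlus Γ) = 1 := by
  apply Units.ext
  simp [sqrtUnit]

/-- `b^{1/2}` as an element of the radical group `Γ_∞`. -/
def radSqrt (b : gammaZeroPlus Γ) : radicalGroup Γ :=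
  ⟨sqrtUnit b, by
    obtain ⟨n, hn, q, hq, h⟩ := b.2.1
    exact ⟨2 * n, by omega, q, hq, by rw [pow_mul, sqrtUnit_sq, h]⟩⟩

/-- `b^{1/2}` as an element of the multiplicative group of the cyclotomic field `ℚ(μ_∞)`. -/
def cycSqrt (b : gammaZeroPlus Γ) : cycFieldˣ :=
  Units.mk0 ⟨sqrtUnit b, sqrt_rat_mem_cycField (gammaZeroPlus_pos b)⟩
    (fun h => sqrt_ne_zero b (congrArg Subtype.val h))

theorem radSqrt_mul (b c : gammaZeroPlus Γ) : radSqrt (b * c) = radSqrt b * radSqrt c :=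
  Subtype.ext (sqrtUnit_mul b c)

theorem radSqrt_one : radSqrt (1 : gammaZeroPlus Γ) = 1 := Subtype.ext sqrtUnit_one

theorem cycSqrt_mul (b c : gammaZeroPlus Γ) : cycSqrt (b * c) = cycSqrt b * cycSqrt c :=
  Units.ext (Subtype.ext (congrArg Units.val (sqrtUnit_mul b c)))

theorem cycSqrt_one : cycSqrt (1 : gammaZeroPlus Γ) = 1 :=
  Units.ext (Subtype.ext (congrArg Units.val sqrtUnit_one))

theorem radSqrt_sq (b : gammaZeroPlus Γ) : ((radSqrt b ^ 2 : radicalGroup Γ) : ℂˣ) = ratUnit b :=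
  sqrtUnit_sq b

theorem cycSqrt_sq (b : gammaZeroPlus Γ) :
    ((cycSqrt b : cycField)) ^ 2 = algebraMap ℚ cycField ((b : ℚˣ) : ℚ) :=
  Subtype.ext (congrArg Units.val (sqrtUnit_sq b))

/-- `α(b^{1/2}) / b^{1/2} ∈ Γ_∞`. -/
def phiTwoVal (b : gammaZeroPlus Γ) (α : radicalAut Γ) : radicalGroup Γ :=
  (α : MulAut (radicalGroup Γ)) (radSqrt b) / radSqrt b

theorem phiTwoVal_sq (b : gammaZeroPlus Γ) (α : radicalAut Γ) : phiTwoVal b α ^ 2 = 1 := by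
  rw [phiTwoVal, div_pow, div_eq_one, ← map_pow, α.2 (radSqrt b ^ 2) ⟨b, (radSqrt_sq b).symm⟩]

theorem radicalAut_apply_of_sq_eq_one (α : radicalAut Γ) {x : radicalGroup Γ} (hx : x ^ 2 = 1) :
    (α : MulAut (radicalGroup Γ)) x = x := by
  apply α.2
  have h : (((x : ℂˣ) : ℂ)) ^ 2 = 1 := by
    rw [← Units.val_pow_eq_pow_val, ← Subgroup.coe_pow, hx]; simp
  rcases sq_eq_one_iff.1 h with h | h
  · exact ⟨1, Units.ext (by simp [ratUnit, h])⟩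
  · exact ⟨-1, Units.ext (by simp [ratUnit, h])⟩

theorem phiTwoVal_mul_left (b c : gammaZeroPlus Γ) (α : radicalAut Γ) :
    phiTwoVal (b * c) α = phiTwoVal b α * phiTwoVal c α := by
  rw [phiTwoVal, radSqrt_mul, map_mul, mul_div_mul_comm]; rfl

theorem phiTwoVal_mul_right (b : gammaZeroPlus Γ) (α β : radicalAut Γ) :
    phiTwoVal b (α * β) = phiTwoVal b α * phiTwoVal b β := by
  have h1 : (β : MulAut (radicalGroup Γ)) (radSqrt b) = phiTwoVal b β * radSqrt b :=
    (div_mul_cancel _ _).symm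
  have h2 : ((α * β : radicalAut Γ) : MulAut (radicalGroup Γ)) (radSqrt b) =
      phiTwoVal b β * (α : MulAut (radicalGroup Γ)) (radSqrt b) := by
    rw [Subgroup.coe_mul, MulAut.mul_apply, h1, map_mul,
      radicalAut_apply_of_sq_eq_one α (phiTwoVal_sq b β)]
  rw [phiTwoVal, h2, mul_div_assoc, mul_comm]; rfl

/-- `φ₂(b) = α(b^{1/2}) / b^{1/2} ∈ μ₂`, for `b ∈ Γ₀⁺` and `α = (φ, σ) ∈ A`. Here
`φ(b) = (α(b^{1/n}) / b^{1/n})_n` lies in the Tate module `lim μ_n`, and `φ₂(b)` is its component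
at `n = 2`. -/
def phiTwo : gammaZeroPlus Γ →* (radicalAut Γ →* rootsOfUnity 2 ℂ) where
  toFun b :=
    { toFun := fun α => ⟨phiTwoVal b α, by
        rw [mem_rootsOfUnity, ← Subgroup.coe_pow, phiTwoVal_sq, Subgroup.coe_one]⟩
      map_one' := Subtype.ext (by simp [phiTwoVal])
      map_mul' := fun α β => Subtype.ext (by simp [phiTwoVal_mul_right]) }
  map_one' := MonoidHom.ext fun α => Subtype.ext (by simp [phiTwoVal, radSqrt_one])
  map_mul' b c := MonoidHom.ext fun α => Subtype.ext (by simp [phiTwoVal_mul_left])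

/-- `g(b^{1/2}) / b^{1/2}` for `g ∈ Gal(ℚ(μ_∞)/ℚ)`. -/
def cycVal (b : gammaZeroPlus Γ) (g : Gal(cycField/ℚ)) : cycFieldˣ :=
  Units.map (g : cycField →* cycField) (cycSqrt b) / cycSqrt b

theorem coe_cycVal (b : gammaZeroPlus Γ) (g : Gal(cycField/ℚ)) :
    (cycVal b g : cycField) = g (cycSqrt b) / cycSqrt b := by
  rw [cycVal, Units.val_div_eq_div_val]; rfl

theorem cycVal_sq (b : gammaZeroPlus Γ) (g : Gal(cycField/ℚ)) : (cycVal b g : cycField) ^ 2 = 1 := by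
  rw [coe_cycVal, div_pow, ← map_pow, cycSqrt_sq, AlgEquiv.commutes, div_self]
  rw [← cycSqrt_sq]
  exact pow_ne_zero _ (cycSqrt b).ne_zero

theorem cycVal_mul_left (b c : gammaZeroPlus Γ) (g : Gal(cycField/ℚ)) :
    cycVal (b * c) g = cycVal b g * cycVal c g := by
  rw [cycVal, cycSqrt_mul, map_mul, mul_div_mul_comm]; rfl

theorem cycVal_mul_right (b : gammaZeroPlus Γ) (g h : Gal(cycField/ℚ)) :
    cycVal b (g * h) = cycVal b g * cycVal b h := by
  apply Units.ext
  have hb : (cycSqrt b : cycField) ≠ 0 := (cycSqrt b).ne_zero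
  have h1 : h (cycSqrt b) = (cycVal b h : cycField) * cycSqrt b := by
    rw [coe_cycVal, div_mul_cancel₀ _ hb]
  have h2 : g (cycVal b h : cycField) = cycVal b h := by
    rcases sq_eq_one_iff.1 (cycVal_sq b h) with h | h <;> simp [h]
  rw [Units.val_mul, coe_cycVal b (g * h), AlgEquiv.mul_apply, h1, map_mul, h2, mul_div_assoc,
    ← coe_cycVal, mul_comm]

/-- `(b^{1/2})^{σ-1} ∈ μ₂`, for `b ∈ Γ₀⁺` and `σ ∈ Aut(μ_∞)`. Here `σ` acts on
`b^{1/2} ∈ ℚ(μ_∞)` under the identification `Aut(μ_∞) = Gal(ℚ(μ_∞)/ℚ)`. -/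
def cycSign : gammaZeroPlus Γ →* (MulAut muInf →* rootsOfUnity 2 ℂ) where
  toFun b :=
    { toFun := fun σ => ⟨Units.map (cycField.val : cycField →* ℂ) (cycVal b (cycEquiv.symm σ)), by
        rw [mem_rootsOfUnity, ← map_pow, show cycVal b (cycEquiv.symm σ) ^ 2 = 1 from
          Units.ext (by simpa using cycVal_sq b (cycEquiv.symm σ)), map_one]⟩
      map_one' := Subtype.ext (by
        change Units.map (cycField.val : cycField →* ℂ) (cycVal b (cycEquiv.symm 1)) = 1
        rw [map_one, show cycVal b 1 = 1 from div_self' _, map_one])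
      map_mul' := fun σ τ => Subtype.ext (by
        change Units.map (cycField.val : cycField →* ℂ) (cycVal b (cycEquiv.symm (σ * τ))) =
          Units.map (cycField.val : cycField →* ℂ) (cycVal b (cycEquiv.symm σ)) *
          Units.map (cycField.val : cycField →* ℂ) (cycVal b (cycEquiv.symm τ))
        rw [map_mul, cycVal_mul_right, map_mul]) }
  map_one' := MonoidHom.ext fun σ => Subtype.ext (by
    change Units.map (cycField.val : cycField →* ℂ) (cycVal 1 (cycEquiv.symm σ)) = 1
    rw [cycVal, cycSqrt_one, map_one, div_one, map_one])
  map_mul' b c := MonoidHom.ext fun σ => Subtype.ext (by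
    change Units.map (cycField.val : cycField →* ℂ) (cycVal (b * c) (cycEquiv.symm σ)) =
      Units.map (cycField.val : cycField →* ℂ) (cycVal b (cycEquiv.symm σ)) *
      Units.map (cycField.val : cycField →* ℂ) (cycVal c (cycEquiv.symm σ))
    rw [cycVal_mul_left, map_mul])

theorem radicalAut_apply_mem_muInf (α : radicalAut Γ) {x : radicalGroup Γ}
    (hx : (x : ℂˣ) ∈ muInf) : ((α : MulAut (radicalGroup Γ)) x : ℂˣ) ∈ muInf := by
  obtain ⟨n, hn, h⟩ := mem_muInf.1 hx
  refine mem_muInf.2 ⟨n, hn, ?_⟩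
  rw [← Subgroup.coe_pow, ← map_pow, show x ^ n = 1 from Subtype.ext h, map_one, Subgroup.coe_one]

/-- The restriction map `A → Aut(μ_∞)`, `α = (φ, σ) ↦ σ`. -/
def resMu : radicalAut Γ →* MulAut muInf where
  toFun α :=
    { toFun := fun u => ⟨(α : MulAut (radicalGroup Γ)) ⟨u, muInf_le_radicalGroup Γ u.2⟩,
        radicalAut_apply_mem_muInf α u.2⟩
      invFun := fun u => ⟨((α⁻¹ : radicalAut Γ) : MulAut (radicalGroup Γ))
          ⟨u, muInf_le_radicalGroup Γ u.2⟩, radicalAut_apply_mem_muInf α⁻¹ u.2⟩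
      left_inv := fun u => Subtype.ext (by simp)
      right_inv := fun u => Subtype.ext (by simp)
      map_mul' := fun u v => Subtype.ext (by
        exact congrArg (fun x : radicalGroup Γ => (x : ℂˣ)) (map_mul (α : MulAut (radicalGroup Γ))
          ⟨u, muInf_le_radicalGroup Γ u.2⟩ ⟨v, muInf_le_radicalGroup Γ v.2⟩)) }
  map_one' := rfl
  map_mul' _ _ := rfl

/-- The quadratic characters `χ_[b] : A → μ₂`, `α = (φ, σ) ↦ φ₂(b) · (b^{1/2})^{σ-1}`, for
`b ∈ Γ₀⁺`; they depend multiplicatively on `b`. -/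
def chi : gammaZeroPlus Γ →* (radicalAut Γ →* rootsOfUnity 2 ℂ) where
  toFun b := phiTwo b * (cycSign b).comp resMu
  map_one' := by rw [map_one, map_one, MonoidHom.one_comp, mul_one]
  map_mul' b c := by rw [map_mul, map_mul, MonoidHom.mul_comp, mul_mul_mul_comm]

end Characters

/-- The subgroup `(Γ₀⁺)²` of squares in `Γ₀⁺`. -/
def gammaZeroPlusSq (Γ : Subgroup ℚˣ) : Subgroup (gammaZeroPlus Γ) :=
  (powMonoidHom 2 : gammaZeroPlus Γ →* gammaZeroPlus Γ).range

end RadicalExt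

end

open RadicalExt

/-!
The group `G` is identified with the common kernel of the characters `χ_[b]`, and `A` is shown to
realise every homomorphism `Γ₀⁺ → μ₂`. Hence `A/G` is the dual of `Γ₀⁺/(Γ₀⁺)²`, a finite group of
exponent two and order `2 ^ r`, and the remaining assertions are duality of finite abelian groups
(`flip_bijective_of_bijective`, `card_quotient_sq`).

* `chi_galRep`: a field automorphism `g` moves `b^{1/2}` by the same sign whether `b^{1/2}` is
  regarded as a radical or as a cyclotomic number, so `χ_[b]` is trivial on `G`.
* `mem_range_galRep_iff`: conversely, let all `χ_[b](α)` be trivial. Dividing `α` by a field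
  automorphism that induces the same automorphism of `μ_∞`, one may assume that `α` fixes `μ_∞`, and
  then it fixes all `b^{1/2}` as well. The Kummer characters `g ↦ g(x)/x` of
  `Gal(ℚ(Γ_∞)/ℚ(μ_∞))` are linearly independent when distinct (Dedekind), and `x`, `y` have the
  same character only if `x/y` is cyclotomic. A cyclotomic radical is a root of unity times some
  `b^{1/2}` (`exists_eq_mul_radSqrt`), hence is fixed by `α`, and so `α(x)/x` depends only on the
  Kummer character of `x`. Therefore `α` preserves every linear relation between radicals and extends
  to a field automorphism (`mem_range_galRep_of_fix`).
* `sq_mem_range_of_real_radical`: the description of cyclotomic radicals rests on the fact that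
  complex conjugation is central in `Gal(ℚ(μ_∞)/ℚ)`: all conjugates of a real cyclotomic radical `ρ`
  are real, so they are `± ρ`, and `ρ ^ 2` is rational.
* `exists_chi_eq`: `b ↦ b^{1/2}` embeds `Γ₀⁺` into `Γ_∞/μ_∞`, and `μ_∞` is divisible, so a
  homomorphism `Γ₀⁺ → μ₂` extends to `θ : Γ_∞/μ_∞ → μ_∞`; the automorphism `x ↦ x θ(x)` induces it.
-/

noncomputable section

namespace RadicalExt

/-! ### Galois theory of the radical extension -/

theorem isIntegral_of_mem_radicalGroup {Γ : Subgroup ℚˣ} {u : ℂˣ} (hu : u ∈ radicalGroup Γ) :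
    IsIntegral ℚ (u : ℂ) := by
  obtain ⟨n, hn, q, -, h⟩ := hu
  refine IsIntegral.of_pow hn ?_
  rw [← Units.val_pow_eq_pow_val, h]
  exact isIntegral_algebraMap

/-- `ℚ(Γ_∞)` is generated by roots of polynomials `X ^ n - q` with `q ∈ Γ`, and contains all roots
of such polynomials. -/
instance normal_adjoinGroup_radicalGroup (Γ : Subgroup ℚˣ) :
    Normal ℚ (adjoinGroup (radicalGroup Γ)) := by
  refine normal_iff.2 fun x => ?_
  have hS : ∀ y ∈ ((fun u : ℂˣ => (u : ℂ)) '' (radicalGroup Γ : Set ℂˣ)), IsIntegral ℚ y ∧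
      ((minpoly ℚ y).map (algebraMap ℚ (adjoinGroup (radicalGroup Γ)))).Splits := by
    rintro _ ⟨u, hu, rfl⟩
    have hint := isIntegral_of_mem_radicalGroup hu
    refine ⟨hint, IntermediateField.splits_of_splits
      (IsAlgClosed.splits _) fun y hy => ?_⟩
    obtain ⟨n, hn, q, hq, h⟩ := hu
    have hu0 : Polynomial.aeval (u : ℂ) (Polynomial.X ^ n - Polynomial.C (q : ℚ)) = 0 := by
      have := congrArg Units.val h
      rw [Units.val_pow_eq_pow_val] at this
      simp [this, ratUnit]
    have hy0 := Polynomial.aeval_eq_zero_of_dvd_aeval_eq_zero (minpoly.dvd ℚ _ hu0)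
      (Polynomial.aeval_eq_zero_of_mem_rootSet hy)
    have hyn : y ^ n = (ratUnit q : ℂ) := by
      simpa [sub_eq_zero, ratUnit] using hy0
    have hne : y ≠ 0 := by
      rintro rfl
      rw [zero_pow hn.ne'] at hyn
      exact (ratUnit q).ne_zero hyn.symm
    exact coe_mem_adjoinGroup (u := Units.mk0 y hne)
      ⟨n, hn, q, hq, Units.ext (by simpa using hyn)⟩
  have hx := IntermediateField.splits_of_mem_adjoin (splits := hS) (hx := x.2)
  rw [← IntermediateField.coe_val, minpoly.algHom_eq (adjoinGroup (radicalGroup Γ)).val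
    (adjoinGroup (radicalGroup Γ)).val.injective] at hx
  have : Algebra.IsAlgebraic ℚ (adjoinGroup (radicalGroup Γ)) :=
    IntermediateField.isAlgebraic_adjoin fun y hy => (hS y hy).1
  exact ⟨(Algebra.IsAlgebraic.isAlgebraic x).isIntegral, hx⟩

theorem muInf_eq_radicalGroup_bot : muInf = radicalGroup ⊥ := by
  ext u
  rw [mem_muInf]
  constructor
  · rintro ⟨n, hn, h⟩
    exact ⟨n, hn, 1, one_mem _, by rw [h, map_one]⟩
  · rintro ⟨n, hn, q, hq, h⟩
    rw [Subgroup.mem_bot.1 hq, map_one] at h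
    exact ⟨n, hn, h⟩

instance normal_cycField : Normal ℚ cycField := by
  rw [cycField, muInf_eq_radicalGroup_bot]
  infer_instance

theorem cycField_le_adjoinGroup (Γ : Subgroup ℚˣ) : cycField ≤ adjoinGroup (radicalGroup Γ) :=
  IntermediateField.adjoin.mono _ _ _ (Set.image_mono (muInf_le_radicalGroup Γ))

/-- A field embedding of `ℚ(H)` is determined by its values on `H`. -/
theorem algHom_ext_adjoinGroup {H : Subgroup ℂˣ} {E : Type*} [Field E] [Algebra ℚ E]
    {f g : adjoinGroup H →ₐ[ℚ] E} (h : ∀ u : H, f (gen u) = g (gen u)) : f = g := by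
  refine IntermediateField.algHom_ext_of_eq_adjoin (S := adjoinGroup H) _ rfl ?_
  rintro _ ⟨u, hu, rfl⟩
  exact h ⟨u, hu⟩

theorem gen_cycEquiv_symm (σ : MulAut muInf) (u : muInf) :
    cycEquiv.symm σ (gen u) = gen (σ u) := by
  rw [← gen_galAction galStable_muInf]
  exact congrArg (fun τ : MulAut muInf => gen (τ u)) (cycEquiv.apply_symm_apply σ)

/-- For `α` in the image of Galois, `σ_α` is the restriction of the field automorphism itself. -/
theorem coe_cycEquiv_symm_resMu {Γ : Subgroup ℚˣ} (g : Gal(adjoinGroup (radicalGroup Γ)/ℚ))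
    (y : cycField) :
    (cycEquiv.symm (resMu (galRep Γ g)) y : ℂ) =
      g (IntermediateField.inclusion (cycField_le_adjoinGroup Γ) y) := by
  have : (cycField.val.comp (cycEquiv.symm (resMu (galRep Γ g)) : cycField →ₐ[ℚ] cycField)) =
      (adjoinGroup (radicalGroup Γ)).val.comp (g.toAlgHom.comp
        (IntermediateField.inclusion (cycField_le_adjoinGroup Γ))) := by
    refine algHom_ext_adjoinGroup fun u => ?_
    change (cycEquiv.symm (resMu (galRep Γ g)) (gen u) : ℂ) = g _
    rw [gen_cycEquiv_symm]
    have := gen_galAction (galStable_radicalGroup Γ) g ⟨u, muInf_le_radicalGroup Γ u.2⟩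
    exact congrArg Subtype.val this
  exact DFunLike.congr_fun this y

/-! ### Radicals in the cyclotomic field -/

/-- Complex conjugation, as a field automorphism of `ℚ(μ_∞)`; it inverts every root of unity. -/
def cycConj : Gal(cycField/ℚ) := cycEquiv.symm (MulEquiv.inv muInf)

theorem coe_cycConj (y : cycField) : (cycConj y : ℂ) = starRingEnd ℂ y := by
  have : cycField.val.comp (cycConj : cycField →ₐ[ℚ] cycField) =
      (Complex.conjAe.toAlgHom.restrictScalars ℚ).comp cycField.val := by
    refine algHom_ext_adjoinGroup fun u => ?_
    change (cycEquiv.symm (MulEquiv.inv muInf) (gen u) : ℂ) = starRingEnd ℂ ((u : ℂˣ) : ℂ)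
    rw [gen_cycEquiv_symm]
    obtain ⟨n, hn, h⟩ := mem_muInf.1 u.2
    have hn1 : ‖((u : ℂˣ) : ℂ)‖ = 1 :=
      Complex.norm_eq_one_of_pow_eq_one (n := n) (by simpa using congrArg Units.val h) hn.ne'
    rw [← Complex.inv_eq_conj hn1]
    simp [gen]
  exact DFunLike.congr_fun this y

theorem cycConj_comm (g : Gal(cycField/ℚ)) (y : cycField) : cycConj (g y) = g (cycConj y) := by
  have : cycConj * g = g * cycConj := by
    apply cycEquiv.injective
    ext1 u
    simp [cycConj]
  exact DFunLike.congr_fun this y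

/-- If a real radical `ρ` of a rational number is cyclotomic, then `ρ ^ 2` is rational: every
conjugate of `ρ` is again real, as complex conjugation is central in `Gal(ℚ(μ_∞)/ℚ)`, and hence
equals `± ρ`. -/
theorem sq_mem_range_of_real_radical {ρ : cycField} (hρ : cycConj ρ = ρ) {n : ℕ} (hn : 0 < n)
    {q : ℚ} (h : ρ ^ n = algebraMap ℚ cycField q) : ∃ b : ℚ, algebraMap ℚ cycField b = ρ ^ 2 := by
  have : IsGalois ℚ cycField := ⟨⟩
  refine (InfiniteGalois.mem_range_algebraMap_iff_fixed (ρ ^ 2)).2 fun g => ?_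
  have hpow : (g ρ) ^ n = ρ ^ n := by rw [← map_pow, h, AlgEquiv.commutes]
  have hreal : ∀ y : cycField, cycConj y = y → ∃ r : ℝ, (y : ℂ) = r := fun y hy =>
    Complex.conj_eq_iff_real.1 (by rw [← coe_cycConj, hy])
  obtain ⟨r, hr⟩ := hreal ρ hρ
  obtain ⟨s, hs⟩ := hreal (g ρ) (by rw [cycConj_comm, hρ])
  have hrs : s ^ n = r ^ n := by
    have := congrArg (fun y : cycField => (y : ℂ)) hpow
    simp only [IntermediateField.coe_pow, hr, hs] at this
    exact_mod_cast this
  have habs : |s| = |r| := by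
    have := congrArg abs hrs
    rw [abs_pow, abs_pow] at this
    exact (pow_left_inj₀ (abs_nonneg _) (abs_nonneg _) hn.ne').1 this
  rw [map_pow]
  apply Subtype.ext
  rw [IntermediateField.coe_pow, IntermediateField.coe_pow, hr, hs]
  exact_mod_cast sq_eq_sq_iff_abs_eq_abs _ _ |>.2 habs

theorem norm_pow_eq {x : ℂˣ} {n : ℕ} {q : ℚˣ} (h : x ^ n = ratUnit q) :
    ‖(x : ℂ)‖ ^ n = |((q : ℚ) : ℝ)| := by
  have := congrArg (fun z : ℂˣ => ‖(z : ℂ)‖) h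
  simpa [ratUnit] using this

/-- A radical of a rational number that is cyclotomic is the product of a root of unity and the
square root of a positive rational number. -/
theorem exists_eq_mul_radSqrt {Γ : Subgroup ℚˣ} (x : radicalGroup Γ)
    (hx : ((x : ℂˣ) : ℂ) ∈ cycField) :
    ∃ (ζ : radicalGroup Γ) (b : gammaZeroPlus Γ), (ζ : ℂˣ) ∈ muInf ∧ x = ζ * radSqrt b := by
  obtain ⟨n, hn, q, hq, h⟩ := x.2
  -- `x` differs from its absolute value `ρ` by a root of unity, so `ρ` is again cyclotomic.
  have hx0 : ‖((x : ℂˣ) : ℂ)‖ ≠ 0 := norm_ne_zero_iff.2 (x : ℂˣ).ne_zero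
  have hnorm := norm_pow_eq h
  let ρ : ℂˣ := Units.mk0 (‖((x : ℂˣ) : ℂ)‖ : ℂ) (by exact_mod_cast hx0)
  have hρ2n : ρ ^ (2 * n) = ratUnit (q ^ 2) := by
    apply Units.ext
    rw [Units.val_pow_eq_pow_val]
    change ((‖((x : ℂˣ) : ℂ)‖ : ℝ) : ℂ) ^ (2 * n) = ((((q ^ 2 : ℚˣ) : ℚ)) : ℂ)
    rw [mul_comm, pow_mul, ← Complex.ofReal_pow, hnorm, ← Complex.ofReal_pow, sq_abs]
    push_cast; rfl
  have hζ : (x : ℂˣ) / ρ ∈ muInf := by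
    refine mem_muInf.2 ⟨2 * n, by omega, ?_⟩
    rw [div_pow, hρ2n, mul_comm, pow_mul, h, map_pow, div_self']
  have hρK : (ρ : ℂ) ∈ cycField := by
    have : (ρ : ℂ) = ((x : ℂˣ) : ℂ) / (((x : ℂˣ) / ρ : ℂˣ) : ℂ) := by
      rw [← Units.val_div_eq_div_val, div_div_cancel]
    rw [this]
    exact div_mem hx (coe_mem_adjoinGroup hζ)
  obtain ⟨b, hb⟩ := sq_mem_range_of_real_radical (ρ := ⟨ρ, hρK⟩) (n := 2 * n) (q := (q : ℚ) ^ 2)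
    (Subtype.ext (by rw [coe_cycConj]; exact Complex.conj_ofReal _)) (by omega)
    (Subtype.ext (by
      have := congrArg Units.val hρ2n
      rw [Units.val_pow_eq_pow_val] at this
      rw [IntermediateField.coe_pow, this]; simp [ratUnit]))
  have hbC : ((b : ℝ) : ℂ) = ((‖((x : ℂˣ) : ℂ)‖ ^ 2 : ℝ) : ℂ) := by
    have := congrArg (fun y : cycField => (y : ℂ)) hb
    simpa [ρ] using this
  have hbR : (b : ℝ) = ‖((x : ℂˣ) : ℂ)‖ ^ 2 := by exact_mod_cast hbC
  have hb0 : 0 < b := by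
    have : (0 : ℝ) < b := by rw [hbR]; positivity
    exact_mod_cast this
  have hbu : ratUnit (Units.mk0 b hb0.ne') = ρ ^ 2 := by
    apply Units.ext
    rw [Units.val_pow_eq_pow_val]
    simpa [ratUnit, ρ] using hbC
  let b' : gammaZeroPlus Γ := ⟨Units.mk0 b hb0.ne',
    ⟨n, hn, q ^ 2, pow_mem hq 2, by rw [hbu, ← pow_mul, hρ2n]⟩, hb0⟩
  have hsqrt : sqrtUnit b' = ρ := by
    apply Units.ext
    change ((√(b : ℝ) : ℝ) : ℂ) = (‖((x : ℂˣ) : ℂ)‖ : ℝ)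
    rw [hbR, Real.sqrt_sq (norm_nonneg _)]
  refine ⟨⟨(x : ℂˣ) / ρ, muInf_le_radicalGroup Γ hζ⟩, b', hζ, Subtype.ext ?_⟩
  change (x : ℂˣ) = x / ρ * sqrtUnit b'
  rw [hsqrt, div_mul_cancel]

/-! ### Independence of characters and the image of Galois -/

/-- Dedekind's independence of characters: a linear relation between the characters `κ x` that holds
pointwise persists when each `κ x` is replaced by a quantity depending only on the character. -/
theorem sum_mul_eq_zero_of_sum_character {X M E : Type*} [Monoid M] [Field E] (κ : X → M →* E)
    {t : X → E} (ht : ∀ x y, κ x = κ y → t x = t y) (s : Finset X) (f : X → E)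
    (h : ∀ m, ∑ x ∈ s, f x * κ x m = 0) : ∑ x ∈ s, f x * t x = 0 := by
  classical
  let F : (M →* E) →₀ E := ∑ x ∈ s, Finsupp.single (κ x) (f x)
  have hF : F = 0 := by
    refine linearIndependent_iff.1 (linearIndependent_monoidHom M E) F ?_
    ext m
    simp [F, map_sum, Finsupp.linearCombination_single, Finset.sum_apply, h m]
  obtain ⟨t', ht'⟩ : ∃ t' : (M →* E) → E, ∀ x, t' (κ x) = t x :=
    ⟨fun χ => if hχ : ∃ x, κ x = χ then t hχ.choose else 0, fun x => by
      have hx : ∃ y, κ y = κ x := ⟨x, rfl⟩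
      change (if hχ : ∃ y, κ y = κ x then t hχ.choose else 0) = t x
      rw [dif_pos hx]
      exact ht _ _ hx.choose_spec⟩
  have := congrArg (Finsupp.linearCombination E t') hF
  simpa [F, map_sum, Finsupp.linearCombination_single, ht'] using this

/-- The inclusion of `H` into its field `ℚ(H)`, as a homomorphism. -/
def genMonoidHom (H : Subgroup ℂˣ) : H →* adjoinGroup H where
  toFun := gen
  map_one' := gen_one
  map_mul' := gen_mul

theorem gen_ne_zero {H : Subgroup ℂˣ} (u : H) : gen u ≠ 0 :=
  fun h => (u : ℂˣ).ne_zero (congrArg Subtype.val h)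

theorem gen_div {H : Subgroup ℂˣ} (u v : H) : gen (u / v) = gen u / gen v := by
  rw [eq_div_iff (gen_ne_zero v), ← gen_mul, div_mul_cancel]

theorem lift_genMonoidHom_surjective (Γ : Subgroup ℚˣ) :
    Function.Surjective (MonoidAlgebra.lift ℚ _ _ (genMonoidHom (radicalGroup Γ))) := by
  rintro ⟨z, hz⟩
  have hz' : z ∈ Algebra.adjoin ℚ ((fun u : ℂˣ => (u : ℂ)) '' (radicalGroup Γ : Set ℂˣ)) := by
    rw [← IntermediateField.adjoin_toSubalgebra_of_isAlgebraic]
    · exact hz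
    · rintro _ ⟨u, hu, rfl⟩
      exact (isIntegral_of_mem_radicalGroup hu).isAlgebraic
  have : Algebra.adjoin ℚ ((fun u : ℂˣ => (u : ℂ)) '' (radicalGroup Γ : Set ℂˣ)) ≤
      ((adjoinGroup (radicalGroup Γ)).val.comp
        (MonoidAlgebra.lift ℚ _ _ (genMonoidHom (radicalGroup Γ)))).range := by
    apply Algebra.adjoin_le
    rintro _ ⟨u, hu, rfl⟩
    refine ⟨MonoidAlgebra.of ℚ (radicalGroup Γ) ⟨u, hu⟩, ?_⟩
    change ((MonoidAlgebra.lift ℚ _ _ (genMonoidHom (radicalGroup Γ))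
      (MonoidAlgebra.of ℚ (radicalGroup Γ) ⟨u, hu⟩) : adjoinGroup (radicalGroup Γ)) : ℂ) = u
    rw [MonoidAlgebra.lift_of]
    rfl
  obtain ⟨x, hx⟩ := this hz'
  exact ⟨x, Subtype.ext hx⟩

section Kummer

variable {Γ : Subgroup ℚˣ}

/-- The subfield `ℚ(μ_∞)` of `ℚ(Γ_∞)`. -/
def cycSubfield (Γ : Subgroup ℚˣ) : IntermediateField ℚ (adjoinGroup (radicalGroup Γ)) :=
  IntermediateField.restrict (cycField_le_adjoinGroup Γ)

/-- A field automorphism moves each element of `Γ_∞` by a root of unity. -/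
theorem galAction_div_mem_muInf (g : Gal(adjoinGroup (radicalGroup Γ)/ℚ)) (x : radicalGroup Γ) :
    ((galAction (galStable_radicalGroup Γ) g x / x : radicalGroup Γ) : ℂˣ) ∈ muInf := by
  obtain ⟨n, hn, q, hq, h⟩ := x.2
  have hfix : galAction (galStable_radicalGroup Γ) g (x ^ n) = x ^ n :=
    (galRep Γ g).2 (x ^ n) ⟨q, h.symm⟩
  refine mem_muInf.2 ⟨n, hn, ?_⟩
  rw [← Subgroup.coe_pow, div_pow, ← map_pow, hfix, div_self', Subgroup.coe_one]

/-- The Kummer character `g ↦ g(x) / x` of `Gal(ℚ(Γ_∞)/ℚ(μ_∞))` attached to `x ∈ Γ_∞`. -/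
def kummerChar (x : radicalGroup Γ) :
    (cycSubfield Γ).fixingSubgroup →* adjoinGroup (radicalGroup Γ) where
  toFun g := (g : Gal(adjoinGroup (radicalGroup Γ)/ℚ)) (gen x) / gen x
  map_one' := by simp [gen_ne_zero]
  map_mul' g h := by
    -- `h x / x` is a root of unity, hence fixed by `g`.
    have hfix : (g : Gal(adjoinGroup (radicalGroup Γ)/ℚ))
        ((h : Gal(adjoinGroup (radicalGroup Γ)/ℚ)) (gen x) / gen x) =
          (h : Gal(adjoinGroup (radicalGroup Γ)/ℚ)) (gen x) / gen x := by
      refine (IntermediateField.mem_fixingSubgroup_iff _ _).1 g.2 _ ?_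
      rw [← gen_galAction (galStable_radicalGroup Γ), ← gen_div]
      exact (IntermediateField.mem_restrict _ _).2
        (coe_mem_adjoinGroup (galAction_div_mem_muInf _ x))
    have hx := gen_ne_zero x
    have hgx : (g : Gal(adjoinGroup (radicalGroup Γ)/ℚ)) (gen x) ≠ 0 :=
      (map_ne_zero _).2 hx
    rw [map_div₀, div_eq_iff hgx] at hfix
    rw [Subgroup.coe_mul, AlgEquiv.mul_apply, hfix]
    ring

/-- If two radicals have the same Kummer character, then their ratio is cyclotomic. -/
theorem div_mem_cycField_of_kummerChar_eq {x y : radicalGroup Γ}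
    (h : kummerChar x = kummerChar y) : (((x / y : radicalGroup Γ) : ℂˣ) : ℂ) ∈ cycField := by
  have : IsGalois ℚ (adjoinGroup (radicalGroup Γ)) := ⟨⟩
  suffices hmem : gen (x / y) ∈ cycSubfield Γ from (IntermediateField.mem_restrict _ _).1 hmem
  rw [← InfiniteGalois.fixedField_fixingSubgroup (cycSubfield Γ)]
  refine (IntermediateField.mem_fixedField_iff _ _).2 fun g hg => ?_
  have hg' : g (gen x) / gen x = g (gen y) / gen y := DFunLike.congr_fun h ⟨g, hg⟩
  have hgy : g (gen y) ≠ 0 := (map_ne_zero _).2 (gen_ne_zero y)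
  rw [gen_div, map_div₀, div_eq_div_iff hgy (gen_ne_zero y)]
  rw [div_eq_div_iff (gen_ne_zero x) (gen_ne_zero y)] at hg'
  rw [hg', mul_comm]

/-- An automorphism in `A` that fixes the roots of unity and the square roots of `Γ₀⁺` comes from a
field automorphism. -/
theorem mem_range_galRep_of_fix (α : radicalAut Γ)
    (hμ : ∀ x : radicalGroup Γ, (x : ℂˣ) ∈ muInf → (α : MulAut (radicalGroup Γ)) x = x)
    (hs : ∀ b : gammaZeroPlus Γ, (α : MulAut (radicalGroup Γ)) (radSqrt b) = radSqrt b) :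
    α ∈ (galRep Γ).range := by
  let s : MulAut (radicalGroup Γ) := α
  let i := genMonoidHom (radicalGroup Γ)
  have ht : ∀ x y : radicalGroup Γ, kummerChar x = kummerChar y →
      gen (s x) / gen x = gen (s y) / gen y := by
    intro x y hxy
    obtain ⟨ζ, b, hζ, hb⟩ := exists_eq_mul_radSqrt (x / y) (div_mem_cycField_of_kummerChar_eq hxy)
    have hfix : s (x / y) = x / y := by
      rw [hb, map_mul]; exact congrArg₂ _ (hμ ζ hζ) (hs b)
    rw [map_div, div_eq_div_iff_div_eq_div] at hfix
    rw [← gen_div, ← gen_div, hfix]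
  have hker : RingHom.ker (MonoidAlgebra.lift ℚ _ _ i) ≤
      RingHom.ker (MonoidAlgebra.lift ℚ _ _ (i.comp s.toMonoidHom)) := by
    intro c hc
    rw [RingHom.mem_ker, MonoidAlgebra.lift_apply'] at hc ⊢
    have key := sum_mul_eq_zero_of_sum_character kummerChar ht c.coeff.support
      (fun x => algebraMap ℚ _ (c.coeff x) * gen x) (fun g => by
        have := congrArg (g : Gal(adjoinGroup (radicalGroup Γ)/ℚ)) hc
        rw [map_zero, Finsupp.sum, map_sum] at this
        rw [← this]
        refine Finset.sum_congr rfl fun x _ => ?_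
        rw [map_mul, AlgEquiv.commutes, mul_assoc]
        exact congrArg _ (mul_div_cancel₀ _ (gen_ne_zero x)))
    rw [← key, Finsupp.sum]
    refine Finset.sum_congr rfl fun x _ => ?_
    rw [mul_assoc]
    exact congrArg _ (mul_div_cancel₀ _ (gen_ne_zero x)).symm
  let t : adjoinGroup (radicalGroup Γ) →ₐ[ℚ] adjoinGroup (radicalGroup Γ) :=
    AlgHom.liftOfSurjective _ (lift_genMonoidHom_surjective Γ) _ hker
  have htgen : ∀ u : radicalGroup Γ, t (gen u) = gen (s u) := by
    intro u
    have h1 : gen u = MonoidAlgebra.lift ℚ _ _ i (MonoidAlgebra.of ℚ (radicalGroup Γ) u) := by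
      rw [MonoidAlgebra.lift_of]; rfl
    have h2 : gen (s u) = MonoidAlgebra.lift ℚ _ _ (i.comp s.toMonoidHom)
        (MonoidAlgebra.of ℚ (radicalGroup Γ) u) := by
      rw [MonoidAlgebra.lift_of]; rfl
    rw [h1, h2]
    exact AlgHom.liftOfSurjective_apply _ _ _ _ _
  refine ⟨AlgEquiv.ofBijective t (Algebra.IsAlgebraic.algHom_bijective t), Subtype.ext ?_⟩
  ext1 u
  apply gen_injective
  change gen (galAction (galStable_radicalGroup Γ) _ u) = gen (s u)
  rw [gen_galAction, ← htgen]
  rfl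

/-- Every automorphism of `μ_∞` is induced by a field automorphism of `ℚ(Γ_∞)`. -/
theorem exists_resMu_galRep_eq (σ : MulAut muInf) :
    ∃ g : Gal(adjoinGroup (radicalGroup Γ)/ℚ), resMu (galRep Γ g) = σ := by
  let e : cycField ≃ₐ[ℚ] cycSubfield Γ :=
    IntermediateField.restrictAlgEquiv (cycField_le_adjoinGroup Γ)
  let τ : cycSubfield Γ ≃ₐ[ℚ] cycSubfield Γ := (e.symm.trans (cycEquiv.symm σ)).trans e
  refine ⟨τ.liftNormal _, ?_⟩
  ext1 u
  apply gen_injective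
  apply Subtype.ext
  rw [← gen_cycEquiv_symm, ← gen_cycEquiv_symm, coe_cycEquiv_symm_resMu]
  have h := AlgEquiv.liftNormal_commutes τ (adjoinGroup (radicalGroup Γ)) (e (gen u))
  have h2 : τ (e (gen u)) = e (cycEquiv.symm σ (gen u)) := by simp [τ]
  rw [h2] at h
  exact congrArg Subtype.val h

theorem coe_chi (b : gammaZeroPlus Γ) (α : radicalAut Γ) :
    (((chi b α : rootsOfUnity 2 ℂ) : ℂˣ) : ℂ) =
      (((α : MulAut (radicalGroup Γ)) (radSqrt b) : ℂˣ) : ℂ) / sqrtUnit b *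
        ((cycEquiv.symm (resMu α) (cycSqrt b) : ℂ) / sqrtUnit b) := by
  change (((phiTwoVal b α : radicalGroup Γ) : ℂˣ) : ℂ) *
    ((cycVal b (cycEquiv.symm (resMu α)) : cycField) : ℂ) = _
  rw [coe_cycVal]
  simp only [phiTwoVal, Subgroup.coe_div, Units.val_div_eq_div_val]
  rfl

theorem chi_galRep (b : gammaZeroPlus Γ) (g : Gal(adjoinGroup (radicalGroup Γ)/ℚ)) :
    chi b (galRep Γ g) = 1 := by
  apply Subtype.ext
  apply Units.ext
  rw [coe_chi, coe_cycEquiv_symm_resMu]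
  have h1 : (((galRep Γ g : MulAut (radicalGroup Γ)) (radSqrt b) : ℂˣ) : ℂ) =
      g (gen (radSqrt b)) :=
    congrArg Subtype.val (gen_galAction (galStable_radicalGroup Γ) g (radSqrt b))
  have h2 : IntermediateField.inclusion (cycField_le_adjoinGroup Γ) (cycSqrt b) =
      gen (radSqrt b) := rfl
  rw [h1, h2, ← pow_two, div_pow]
  have h3 : gen (radSqrt b) ^ 2 = algebraMap ℚ _ ((b : ℚˣ) : ℚ) := by
    rw [← gen_pow]
    exact Subtype.ext (congrArg Units.val (radSqrt_sq b))
  have h4 : (g (gen (radSqrt b)) : ℂ) ^ 2 = (sqrtUnit b : ℂ) ^ 2 := by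
    rw [← IntermediateField.coe_pow, ← map_pow, h3, AlgEquiv.commutes, ← h3]
    rfl
  rw [h4]
  exact div_self (pow_ne_zero _ (sqrtUnit b).ne_zero)

theorem coe_chi_of_resMu_eq_one {α : radicalAut Γ} (h : resMu α = 1) (b : gammaZeroPlus Γ) :
    ((chi b α : rootsOfUnity 2 ℂ) : ℂˣ) =
      (α : MulAut (radicalGroup Γ)) (radSqrt b) / radSqrt b := by
  apply Units.ext
  rw [coe_chi, h, map_one]
  have : ((cycSqrt b : cycField) : ℂ) / sqrtUnit b = 1 := div_self (sqrtUnit b).ne_zero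
  rw [AlgEquiv.one_apply, this, mul_one, Units.val_div_eq_div_val]
  rfl

/-- The image of Galois in `A` is the common kernel of the quadratic characters. -/
theorem mem_range_galRep_iff (α : radicalAut Γ) :
    α ∈ (galRep Γ).range ↔ ∀ b : gammaZeroPlus Γ, chi b α = 1 := by
  constructor
  · rintro ⟨g, rfl⟩ b
    exact chi_galRep b g
  intro h
  obtain ⟨g, hg⟩ := exists_resMu_galRep_eq (Γ := Γ) (resMu α)
  -- Division by `galRep Γ g` reduces to an automorphism that is trivial on `μ_∞`.
  have hres : resMu ((galRep Γ g)⁻¹ * α) = 1 := by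
    rw [map_mul, map_inv, hg, inv_mul_cancel]
  have hchi : ∀ b : gammaZeroPlus Γ, chi b ((galRep Γ g)⁻¹ * α) = 1 := fun b => by
    rw [map_mul, map_inv, chi_galRep, h b, inv_one, one_mul]
  have := mem_range_galRep_of_fix ((galRep Γ g)⁻¹ * α)
    (fun x hx => Subtype.ext (congrArg (fun σ : MulAut muInf => ((σ ⟨x, hx⟩ : muInf) : ℂˣ)) hres))
    (fun b => Subtype.ext (by
      have := coe_chi_of_resMu_eq_one hres b
      rw [hchi b, eq_comm] at this
      exact div_eq_one.1 this))
  have h2 := mul_mem (MonoidHom.mem_range.2 ⟨g, rfl⟩ : galRep Γ g ∈ (galRep Γ).range) this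
  rwa [mul_inv_cancel_left] at h2

end Kummer

/-! ### Surjectivity of the pairing -/

section Surjectivity

theorem pow_surjective_muInf {n : ℕ} (hn : n ≠ 0) :
    Function.Surjective fun u : muInf => u ^ n := by
  intro u
  obtain ⟨m, hm, h⟩ := mem_muInf.1 u.2
  obtain ⟨z, hz⟩ := IsAlgClosed.exists_pow_nat_eq ((u : ℂˣ) : ℂ) (Nat.pos_of_ne_zero hn)
  have hz0 : z ≠ 0 := by
    rintro rfl
    rw [zero_pow hn] at hz
    exact (u : ℂˣ).ne_zero hz.symm
  have hzu : Units.mk0 z hz0 ^ n = (u : ℂˣ) := Units.ext (by simpa using hz)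
  exact ⟨⟨Units.mk0 z hz0, mem_muInf.2 ⟨n * m, Nat.mul_pos (Nat.pos_of_ne_zero hn) hm,
    by rw [pow_mul, hzu, h]⟩⟩, Subtype.ext hzu⟩

/-- The divisible group `μ_∞` is injective among abelian groups. -/
theorem exists_extension_muInf {A B : Type*} [CommGroup A] [CommGroup B] (f : A →* B)
    (hf : Function.Injective f) (g : A →* muInf) : ∃ h : B →* muInf, ∀ a, h (f a) = g a := by
  let _ : DivisibleBy (Additive muInf) ℕ := divisibleByOfSMulRightSurj _ _
    fun {n} hn u => by
      obtain ⟨v, hv⟩ := pow_surjective_muInf hn u.toMul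
      exact ⟨Additive.ofMul v, hv⟩
  let _ : DivisibleBy (Additive muInf) ℤ := AddGroup.divisibleByIntOfDivisibleByNat _
  obtain ⟨h, hh⟩ := (Module.Baer.of_divisible (Additive muInf)).extension_property_addMonoidHom
    (MonoidHom.toAdditive f) hf (MonoidHom.toAdditive g)
  exact ⟨MonoidHom.toAdditive.symm h, fun a => DFunLike.congr_fun hh (Additive.ofMul a)⟩

variable {Γ : Subgroup ℚˣ}

theorem eq_one_of_sqrtUnit_mem_muInf {b : gammaZeroPlus Γ} (h : sqrtUnit b ∈ muInf) : b = 1 := by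
  obtain ⟨n, hn, h⟩ := mem_muInf.1 h
  have hb : (0 : ℝ) < (((b : ℚˣ) : ℚ) : ℝ) := by exact_mod_cast gammaZeroPlus_pos b
  have h1 : (√((((b : ℚˣ) : ℚ) : ℝ))) ^ n = 1 := by
    have : ((√((((b : ℚˣ) : ℚ) : ℝ)) : ℝ) : ℂ) ^ n = 1 := by
      simpa [sqrtUnit] using congrArg Units.val h
    exact_mod_cast this
  have h2 := (pow_eq_one_iff_of_nonneg (Real.sqrt_nonneg _) hn.ne').1 h1
  rw [Real.sqrt_eq_one] at h2
  have h3 : ((b : ℚˣ) : ℚ) = 1 := by exact_mod_cast h2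
  exact Subtype.ext (Units.ext h3)

/-- The automorphism `x ↦ x θ(x)` of `Γ_∞` attached to a homomorphism `θ : Γ_∞ → μ_∞` that is
trivial on `μ_∞`. -/
def twist (θ : radicalGroup Γ →* muInf)
    (hθ : ∀ x : radicalGroup Γ, (x : ℂˣ) ∈ muInf → θ x = 1) : MulAut (radicalGroup Γ) :=
  let j : muInf →* radicalGroup Γ := Subgroup.inclusion (muInf_le_radicalGroup Γ)
  { toFun := fun x => x * j (θ x)
    invFun := fun x => x * (j (θ x))⁻¹
    left_inv := fun x => by
      simp [hθ (j (θ x)) (θ x).2]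
    right_inv := fun x => by
      simp [hθ (j (θ x)) (θ x).2]
    map_mul' := fun x y => by
      rw [map_mul, map_mul, mul_mul_mul_comm] }

/-- A rational element of `Γ_∞` is `± b` with `b ∈ Γ₀⁺`. -/
theorem exists_gammaZeroPlus_mul_sign (x : radicalGroup Γ) {q : ℚˣ} (hq : ratUnit q = x) :
    ∃ (b : gammaZeroPlus Γ) (ζ : radicalGroup Γ), (ζ : ℂˣ) ∈ muInf ∧ x = ζ * radSqrt b ^ 2 := by
  have hmul : ∀ u : ℂˣ, u ^ 2 = 1 → u ∈ muInf := fun u hu => mem_muInf.2 ⟨2, by norm_num, hu⟩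
  have hsign : ratUnit (-1) ∈ muInf := hmul _ (by rw [← map_pow]; simp)
  rcases lt_or_gt_of_ne q.ne_zero with h | h
  · have hmem : ratUnit (-q) ∈ radicalGroup Γ := by
      rw [show -q = -1 * q by simp, map_mul, hq]
      exact mul_mem (muInf_le_radicalGroup Γ hsign) x.2
    refine ⟨⟨-q, hmem, ?_⟩, ⟨ratUnit (-1), muInf_le_radicalGroup Γ hsign⟩, hsign,
      Subtype.ext ?_⟩
    · exact (Units.mem_posSubgroup _).2 (by simpa using h)
    · rw [Subgroup.coe_mul, radSqrt_sq]
      simp [← map_mul, hq]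
  · refine ⟨⟨q, by
      change ratUnit q ∈ radicalGroup Γ
      rw [hq]; exact x.2, (Units.mem_posSubgroup _).2 h⟩, 1,
      one_mem _, Subtype.ext ?_⟩
    rw [Subgroup.coe_mul, radSqrt_sq]
    simp [hq]

/-- Every homomorphism `Γ₀⁺ → μ₂` has the form `b ↦ χ_[b](α)`, for some `α ∈ A` that is the identity
on `μ_∞`. -/
theorem exists_chi_eq (ψ : gammaZeroPlus Γ →* rootsOfUnity 2 ℂ) :
    ∃ α : radicalAut Γ, ∀ b, chi b α = ψ b := by
  let T : Subgroup (radicalGroup Γ) := muInf.subgroupOf (radicalGroup Γ)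
  let s : gammaZeroPlus Γ →* radicalGroup Γ :=
    { toFun := radSqrt, map_one' := radSqrt_one, map_mul' := radSqrt_mul }
  let f : gammaZeroPlus Γ →* radicalGroup Γ ⧸ T := (QuotientGroup.mk' T).comp s
  have hinj : Function.Injective f := by
    rw [injective_iff_map_eq_one]
    intro b hb
    exact eq_one_of_sqrtUnit_mem_muInf ((QuotientGroup.eq_one_iff (s b)).1 hb)
  have hmu : rootsOfUnity 2 ℂ ≤ muInf := fun u hu => mem_muInf.2 ⟨2, by norm_num, hu⟩
  obtain ⟨h, hh⟩ := exists_extension_muInf (A := gammaZeroPlus Γ)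
    (B := radicalGroup Γ ⧸ T) f hinj ((Subgroup.inclusion hmu).comp ψ)
  let θ : radicalGroup Γ →* muInf := h.comp (QuotientGroup.mk' T)
  have hθ : ∀ x : radicalGroup Γ, (x : ℂˣ) ∈ muInf → θ x = 1 := fun x hx => by
    have : QuotientGroup.mk' T x = 1 := (QuotientGroup.eq_one_iff x).2 hx
    rw [MonoidHom.comp_apply, this, map_one]
  have hθs : ∀ b, θ (radSqrt b) = Subgroup.inclusion hmu (ψ b) := hh
  -- The twist fixes the rational elements `± b`, as `θ b = θ (b^{1/2}) ^ 2 = ψ b ^ 2 = 1`.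
  have hfix : ∀ x, θ x = 1 → twist θ hθ x = x := fun x hx => by
    change x * Subgroup.inclusion _ (θ x) = x
    rw [hx, map_one, mul_one]
  refine ⟨⟨twist θ hθ, fun x ⟨q, hq⟩ => hfix x ?_⟩, fun b => ?_⟩
  · obtain ⟨b, ζ, hζ, rfl⟩ := exists_gammaZeroPlus_mul_sign x hq
    have hψ : ψ b ^ 2 = 1 := Subtype.ext ((mem_rootsOfUnity _ _).1 (ψ b).2)
    rw [map_mul, map_pow, hθ ζ hζ, hθs, ← map_pow, hψ, map_one, one_mul]
  · apply Subtype.ext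
    rw [coe_chi_of_resMu_eq_one]
    · change ((radSqrt b * Subgroup.inclusion (muInf_le_radicalGroup Γ) (θ (radSqrt b)) :
        radicalGroup Γ) : ℂˣ) / radSqrt b = ψ b
      rw [hθs, Subgroup.coe_mul, mul_div_cancel_left]
      rfl
    · ext1 u
      apply Subtype.ext
      exact congrArg (fun y : radicalGroup Γ => (y : ℂˣ))
        (hfix ⟨u, muInf_le_radicalGroup Γ u.2⟩ (hθ _ u.2))

end Surjectivity

/-! ### The structure of `Γ₀⁺` -/

section Rank

/-- The `p`-adic valuation on `ℚ*`, written additively, as a homomorphism. -/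
def padicValHom (p : ℕ) [Fact p.Prime] : Additive ℚˣ →+ ℤ where
  toFun q := padicValRat p ((q.toMul : ℚˣ) : ℚ)
  map_zero' := by simp
  map_add' q t := by
    rw [toMul_add, Units.val_mul, padicValRat.mul (Units.ne_zero _) (Units.ne_zero _)]

theorem not_dvd_of_padicValRat_eq_zero {p : ℕ} [hp : Fact p.Prime] {q : ℚ} (hq : q ≠ 0)
    (h : padicValRat p q = 0) : ¬ p ∣ q.num.natAbs ∧ ¬ p ∣ q.den := by
  have hnum : q.num.natAbs ≠ 0 := by simpa using hq
  rw [padicValRat_def, padicValInt, sub_eq_zero, Nat.cast_inj] at h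
  have hnot : ¬ (p ∣ q.num.natAbs ∧ p ∣ q.den) := fun ⟨h1, h2⟩ =>
    Nat.not_coprime_of_dvd_of_dvd hp.1.one_lt h1 h2 q.reduced
  have h1 := dvd_iff_padicValNat_ne_zero (p := p) hnum
  have h2 := dvd_iff_padicValNat_ne_zero (p := p) q.den_ne_zero
  rw [h] at h1
  tauto

theorem padicValRat_eq_zero_of_not_dvd {p : ℕ} {q : ℚ}
    (h : ¬ p ∣ q.num.natAbs ∧ ¬ p ∣ q.den) : padicValRat p q = 0 := by
  rw [padicValRat_def, padicValInt, padicValNat.eq_zero_of_not_dvd h.1,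
    padicValNat.eq_zero_of_not_dvd h.2]
  simp

theorem eq_one_of_forall_padicValRat_eq_zero {q : ℚ} (hq : 0 < q)
    (h : ∀ p : ℕ, p.Prime → padicValRat p q = 0) : q = 1 := by
  have key : ∀ p : ℕ, p.Prime → ¬ p ∣ q.num.natAbs ∧ ¬ p ∣ q.den := fun p hp =>
    have : Fact p.Prime := ⟨hp⟩
    not_dvd_of_padicValRat_eq_zero hq.ne' (h p hp)
  have h1 := Nat.eq_one_iff_not_exists_prime_dvd.2 fun p hp => (key p hp).1
  have h2 := Nat.eq_one_iff_not_exists_prime_dvd.2 fun p hp => (key p hp).2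
  have h3 : q.num = 1 := by
    have := Rat.num_pos.2 hq
    omega
  exact Rat.ext h3 h2

/-- Only finitely many primes occur in a finitely generated group of rational numbers. -/
theorem exists_finset_padicValRat_eq_zero {Γ : Subgroup ℚˣ} (hΓ : Γ.FG) :
    ∃ S : Finset ℕ, ∀ p : ℕ, p.Prime → p ∉ S → ∀ q ∈ Γ, padicValRat p ((q : ℚˣ) : ℚ) = 0 := by
  obtain ⟨T, rfl⟩ := hΓ
  refine ⟨T.biUnion fun t => (t : ℚ).num.natAbs.primeFactors ∪ (t : ℚ).den.primeFactors,
    fun p hp hpS q hq => ?_⟩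
  have : Fact p.Prime := ⟨hp⟩
  induction hq using Subgroup.closure_induction with
  | mem t ht =>
    apply padicValRat_eq_zero_of_not_dvd
    simp only [Finset.mem_biUnion, Finset.mem_union, Nat.mem_primeFactors, not_exists, not_and,
      not_or] at hpS
    obtain ⟨h1, h2⟩ := hpS t ht
    exact ⟨fun h => h1 hp h (by simp), fun h => h2 hp h (Rat.den_ne_zero _)⟩
  | one => simp
  | mul x y _ _ hx hy =>
    rw [Units.val_mul, padicValRat.mul x.ne_zero y.ne_zero, hx, hy, add_zero]
  | inv x _ hx => rw [Units.val_inv_eq_inv_val, padicValRat.inv, hx, neg_zero]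

theorem exists_pow_mem_of_gammaZeroPlus {Γ : Subgroup ℚˣ} (b : gammaZeroPlus Γ) :
    ∃ n : ℕ, 0 < n ∧ (b : ℚˣ) ^ n ∈ Γ := by
  obtain ⟨n, hn, q, hq, h⟩ := b.2.1
  have hinj : Function.Injective ratUnit := Units.map_injective (algebraMap ℚ ℂ).injective
  rw [← map_pow] at h
  exact ⟨n, hn, hinj h ▸ hq⟩

/-- The valuations at finitely many primes embed `Γ₀⁺` into a lattice. -/
theorem exists_linearMap_injective {Γ : Subgroup ℚˣ} (hΓ : Γ.FG) :
    ∃ (S : Finset ℕ) (f : Additive (gammaZeroPlus Γ) →ₗ[ℤ] (S → ℤ)), Function.Injective f := by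
  obtain ⟨S, hS⟩ := exists_finset_padicValRat_eq_zero hΓ
  let P : Finset ℕ := S.filter Nat.Prime
  have hP : ∀ p : P, Fact (p : ℕ).Prime := fun p => ⟨(Finset.mem_filter.1 p.2).2⟩
  let f : Additive (gammaZeroPlus Γ) →+ (P → ℤ) := AddMonoidHom.mk' (fun b p =>
      padicValHom p (Additive.ofMul (b.toMul : ℚˣ))) (fun b c => by
    ext p
    exact map_add (padicValHom p) _ _)
  refine ⟨P, f.toIntLinearMap, (injective_iff_map_eq_zero f).2 fun b hb => ?_⟩
  have hb1 : (((b.toMul : gammaZeroPlus Γ) : ℚˣ) : ℚ) = 1 := by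
    refine eq_one_of_forall_padicValRat_eq_zero (gammaZeroPlus_pos b.toMul) fun p hp => ?_
    by_cases hpS : p ∈ S
    · exact congrFun hb ⟨p, Finset.mem_filter.2 ⟨hpS, hp⟩⟩
    · obtain ⟨n, hn, hmem⟩ := exists_pow_mem_of_gammaZeroPlus b.toMul
      have : Fact p.Prime := ⟨hp⟩
      have h := hS p hp hpS _ hmem
      rw [Units.val_pow_eq_pow_val, padicValRat.pow] at h
      exact (mul_eq_zero.1 h).resolve_left (by exact_mod_cast hn.ne')
  exact Additive.toMul.injective (Subtype.ext (Units.ext hb1))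

theorem finite_gammaZeroPlus {Γ : Subgroup ℚˣ} (hΓ : Γ.FG) :
    Module.Finite ℤ (Additive (gammaZeroPlus Γ)) := by
  obtain ⟨S, f, hf⟩ := exists_linearMap_injective hΓ
  exact Module.Finite.of_injective f hf

theorem free_gammaZeroPlus {Γ : Subgroup ℚˣ} (hΓ : Γ.FG) :
    Module.Free ℤ (Additive (gammaZeroPlus Γ)) := by
  have := finite_gammaZeroPlus hΓ
  obtain ⟨S, f, hf⟩ := exists_linearMap_injective hΓ
  have : Module.IsTorsionFree ℤ (Additive (gammaZeroPlus Γ)) :=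
    hf.moduleIsTorsionFree f fun r x => map_smul f r x
  infer_instance

/-- A linear map with torsion kernel and torsion cokernel preserves the rank. -/
theorem finrank_eq_of_torsion {R M N : Type*} [CommRing R] [IsDomain R] [AddCommGroup M]
    [AddCommGroup N] [Module R M] [Module R N] [Module.Finite R M] [Module.Finite R N]
    (f : M →ₗ[R] N) (hker : Module.IsTorsion R (LinearMap.ker f))
    (hcoker : Module.IsTorsion R (N ⧸ LinearMap.range f)) :
    Module.finrank R M = Module.finrank R N := by
  have h1 := (LinearMap.ker f).finrank_quotient_add_finrank
  have h2 := (LinearMap.range f).finrank_quotient_add_finrank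
  rw [hker.finrank_eq_zero, add_zero, f.quotKerEquivRange.finrank_eq] at h1
  rw [hcoker.finrank_eq_zero, zero_add] at h2
  rw [← h1, h2]

/-- Squaring maps `Γ` to `Γ₀⁺` with torsion kernel and torsion cokernel. -/
theorem finrank_gammaZeroPlus {Γ : Subgroup ℚˣ} (hΓ : Γ.FG) :
    Module.finrank ℤ (Additive (gammaZeroPlus Γ)) = Module.finrank ℤ (Additive Γ) := by
  have := finite_gammaZeroPlus hΓ
  have : Group.FG Γ := (Group.fg_iff_subgroup_fg Γ).2 hΓ
  have : Module.Finite ℤ (Additive Γ) := Module.Finite.iff_addGroup_fg.2 inferInstance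
  let f : Γ →* gammaZeroPlus Γ := MonoidHom.mk' (fun q => ⟨(q : ℚˣ) ^ 2,
      ⟨1, one_pos, _, pow_mem q.2 2, pow_one _⟩,
      (Units.mem_posSubgroup _).2 (by
        rw [Units.val_pow_eq_pow_val]
        exact sq_pos_of_ne_zero (Units.ne_zero _))⟩)
    fun q t => Subtype.ext (mul_pow (q : ℚˣ) t 2)
  symm
  refine finrank_eq_of_torsion (MonoidHom.toAdditive f).toIntLinearMap ?_ ?_
  · rintro ⟨x, hx⟩
    refine ⟨⟨2, by simp⟩, Subtype.ext ?_⟩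
    have hx' : f x.toMul = 1 := hx
    have : x.toMul ^ 2 = 1 := Subtype.ext (congrArg (fun b : gammaZeroPlus Γ => (b : ℚˣ)) hx')
    change (2 : ℤ) • x = 0
    rw [ofNat_zsmul]
    exact this
  · intro y
    obtain ⟨b, rfl⟩ := Submodule.Quotient.mk_surjective _ y
    obtain ⟨n, hn, hmem⟩ := exists_pow_mem_of_gammaZeroPlus b.toMul
    refine ⟨⟨(n * 2 : ℕ), by simpa using hn.ne'⟩, ?_⟩
    rw [Submonoid.mk_smul, ← Submodule.Quotient.mk_smul, Submodule.Quotient.mk_eq_zero]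
    refine ⟨Additive.ofMul ⟨_, hmem⟩, ?_⟩
    rw [natCast_zsmul]
    exact Subtype.ext (pow_mul _ n 2).symm

/-- Doubling on the free group `Γ₀⁺`, written additively, has determinant `2 ^ r`. -/
theorem card_quotient_sq {Γ : Subgroup ℚˣ} (hΓ : Γ.FG) :
    Nat.card (gammaZeroPlus Γ ⧸ gammaZeroPlusSq Γ) = 2 ^ Module.finrank ℤ (Additive Γ) := by
  have := finite_gammaZeroPlus hΓ
  have := free_gammaZeroPlus hΓ
  let d : Additive (gammaZeroPlus Γ) →ₗ[ℤ] Additive (gammaZeroPlus Γ) := (2 : ℤ) • LinearMap.id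
  have hd : Function.Injective d := fun x y hxy => by
    exact smul_right_injective _ (two_ne_zero (α := ℤ)) hxy
  have h := Submodule.natAbs_det_equiv (LinearMap.range d) (LinearEquiv.ofInjective d hd)
  have h1 : (LinearMap.range d).subtype ∘ₗ AddMonoidHom.toIntLinearMap
      ((LinearEquiv.ofInjective d hd : _ ≃ₗ[ℤ] _) : _ →+ _) = d := by
    ext x; rfl
  rw [h1, LinearMap.det_smul, LinearMap.det_id, mul_one, Int.natAbs_pow,
    finrank_gammaZeroPlus hΓ] at h
  have h2 : (LinearMap.range d).toAddSubgroup = Subgroup.toAddSubgroup (gammaZeroPlusSq Γ) := by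
    ext x
    constructor
    · rintro ⟨y, rfl⟩
      exact ⟨y.toMul, (ofNat_zsmul y 2).symm⟩
    · rintro ⟨y, hy⟩
      exact ⟨Additive.ofMul y, (ofNat_zsmul (Additive.ofMul y) 2).trans hy⟩
  change (gammaZeroPlusSq Γ).index = _
  rw [← Subgroup.index_toAddSubgroup, ← h2]
  exact h.symm

end Rank

/-! ### Duality -/

theorem hom_eq_one_of_mem_sq {Γ : Subgroup ℚˣ} (ψ : gammaZeroPlus Γ →* rootsOfUnity 2 ℂ)
    {b : gammaZeroPlus Γ} (hb : b ∈ gammaZeroPlusSq Γ) : ψ b = 1 := by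
  obtain ⟨c, rfl⟩ := hb
  change ψ (c ^ 2) = 1
  rw [map_pow]
  exact Subtype.ext ((mem_rootsOfUnity _ _).1 (ψ c).2)

/-- The homomorphism `A → Hom(Γ₀⁺/(Γ₀⁺)², μ₂)`, `α ↦ (b ↦ χ_[b](α))`. -/
def chiHom (Γ : Subgroup ℚˣ) :
    radicalAut Γ →* ((gammaZeroPlus Γ ⧸ gammaZeroPlusSq Γ) →* rootsOfUnity 2 ℂ) where
  toFun α := QuotientGroup.lift _ (chi.flip α) fun _ hb => hom_eq_one_of_mem_sq _ hb
  map_one' := QuotientGroup.monoidHom_ext _ (by ext; simp)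
  map_mul' α β := QuotientGroup.monoidHom_ext _ (MonoidHom.ext fun b => map_mul (chi b) α β)

theorem chiHom_mk {Γ : Subgroup ℚˣ} (α : radicalAut Γ) (b : gammaZeroPlus Γ) :
    chiHom Γ α (QuotientGroup.mk b) = chi b α := rfl

theorem ker_chiHom (Γ : Subgroup ℚˣ) : (chiHom Γ).ker = (galRep Γ).range := by
  ext α
  rw [mem_range_galRep_iff, MonoidHom.mem_ker]
  constructor
  · intro h b
    rw [← chiHom_mk, h, MonoidHom.one_apply]
  · intro h
    exact QuotientGroup.monoidHom_ext _ (MonoidHom.ext h)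

theorem chiHom_surjective (Γ : Subgroup ℚˣ) : Function.Surjective (chiHom Γ) := by
  intro ψ
  obtain ⟨α, hα⟩ := exists_chi_eq (ψ.comp (QuotientGroup.mk' _))
  exact ⟨α, QuotientGroup.monoidHom_ext _ (MonoidHom.ext hα)⟩

section ExponentTwo

variable {V : Type*} [CommGroup V] (hV : ∀ v : V, v ^ 2 = 1)
include hV

/-- The characters of a group of exponent two take values in `μ₂`. -/
def homRootsOfUnityTwoEquiv : (V →* rootsOfUnity 2 ℂ) ≃* (V →* ℂˣ) where
  toFun ψ := (rootsOfUnity 2 ℂ).subtype.comp ψ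
  invFun φ := φ.codRestrict _ fun v => by
    rw [mem_rootsOfUnity, ← map_pow, hV, map_one]
  left_inv _ := rfl
  right_inv _ := rfl
  map_mul' _ _ := rfl

theorem hasEnoughRootsOfUnity_exponent [Finite V] :
    HasEnoughRootsOfUnity ℂ (Monoid.exponent V) :=
  HasEnoughRootsOfUnity.of_dvd ℂ (Monoid.exponent_dvd_of_forall_pow_eq_one hV)

theorem card_hom_rootsOfUnity_two [Finite V] : Nat.card (V →* rootsOfUnity 2 ℂ) = Nat.card V := by
  have := hasEnoughRootsOfUnity_exponent hV
  rw [Nat.card_congr (homRootsOfUnityTwoEquiv hV).toEquiv,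
    CommGroup.card_monoidHom_of_hasEnoughRootsOfUnity]

/-- A pairing with a finite group of exponent two that is perfect on one side is perfect on the
other. -/
theorem flip_bijective_of_bijective [Finite V] {W : Type*} [Group W]
    (P : W →* (V →* rootsOfUnity 2 ℂ)) (hP : Function.Bijective P) :
    Function.Bijective P.flip := by
  have := hasEnoughRootsOfUnity_exponent hV
  let e : W ≃* (V →* rootsOfUnity 2 ℂ) := MulEquiv.ofBijective P hP
  have hcard : Nat.card (W →* rootsOfUnity 2 ℂ) = Nat.card V := by
    have : Finite (V →* rootsOfUnity 2 ℂ) := Nat.finite_of_card_ne_zero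
      (by rw [card_hom_rootsOfUnity_two hV]; exact Nat.card_pos.ne')
    rw [Nat.card_congr e.monoidHomCongrLeft.toEquiv,
      card_hom_rootsOfUnity_two (V := V →* rootsOfUnity 2 ℂ), card_hom_rootsOfUnity_two hV]
    exact fun ψ => MonoidHom.ext fun v => by
      rw [MonoidHom.pow_apply, ← map_pow, hV, map_one, MonoidHom.one_apply]
  have : Finite (W →* rootsOfUnity 2 ℂ) := Nat.finite_of_card_ne_zero
    (by rw [hcard]; exact Nat.card_pos.ne')
  refine (Nat.bijective_iff_injective_and_card _).2 ⟨?_, hcard.symm⟩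
  rw [injective_iff_map_eq_one]
  intro v hv
  by_contra hne
  obtain ⟨φ, hφ⟩ := CommGroup.exists_apply_ne_one_of_hasEnoughRootsOfUnity V ℂ hne
  obtain ⟨w, hw⟩ := hP.2 ((homRootsOfUnityTwoEquiv hV).symm φ)
  apply hφ
  have h1 : P w v = 1 := DFunLike.congr_fun hv w
  rw [hw] at h1
  exact congrArg Subtype.val h1

end ExponentTwo

theorem sq_eq_one_of_quotient_sq {Γ : Subgroup ℚˣ} (y : gammaZeroPlus Γ ⧸ gammaZeroPlusSq Γ) :
    y ^ 2 = 1 := by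
  obtain ⟨b, rfl⟩ := QuotientGroup.mk_surjective y
  rw [← QuotientGroup.mk_pow]
  exact (QuotientGroup.eq_one_iff _).2 ⟨b, rfl⟩

end RadicalExt

end

theorem theorem2p5 (Γ : Subgroup ℚˣ) (hΓ : Γ.FG) :
    Function.Injective (galRep Γ) ∧
    (galRep Γ).range.index = 2 ^ Module.finrank ℤ (Additive Γ) ∧
    ∃ _ : (galRep Γ).range.Normal,
      (∀ x y : radicalAut Γ ⧸ (galRep Γ).range, x * y = y * x) ∧
      (∀ x : radicalAut Γ ⧸ (galRep Γ).range, x ^ 2 = 1) ∧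
      (∀ y : gammaZeroPlus Γ ⧸ gammaZeroPlusSq Γ, y ^ 2 = 1) ∧
      ∃ P : (radicalAut Γ ⧸ (galRep Γ).range) →*
          ((gammaZeroPlus Γ ⧸ gammaZeroPlusSq Γ) →* rootsOfUnity 2 ℂ),
        (∀ (α : radicalAut Γ) (b : gammaZeroPlus Γ),
          P (QuotientGroup.mk α) (QuotientGroup.mk b) = chi b α) ∧
        Function.Bijective P ∧ Function.Bijective P.flip := by
  have hnormal : (galRep Γ).range.Normal := ker_chiHom Γ ▸ (chiHom Γ).normal_ker
  let P : (radicalAut Γ ⧸ (galRep Γ).range) →*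
      ((gammaZeroPlus Γ ⧸ gammaZeroPlusSq Γ) →* rootsOfUnity 2 ℂ) :=
    QuotientGroup.lift _ (chiHom Γ) (ker_chiHom Γ).ge
  have hP : Function.Bijective P := by
    refine ⟨(injective_iff_map_eq_one P).2 fun x hx => ?_, fun ψ => ?_⟩
    · obtain ⟨α, rfl⟩ := QuotientGroup.mk_surjective x
      exact (QuotientGroup.eq_one_iff α).2 ((ker_chiHom Γ).le hx)
    · obtain ⟨α, rfl⟩ := chiHom_surjective Γ ψ
      exact ⟨QuotientGroup.mk α, rfl⟩
  have hfin : Finite (gammaZeroPlus Γ ⧸ gammaZeroPlusSq Γ) :=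
    Nat.finite_of_card_ne_zero (by rw [card_quotient_sq hΓ]; positivity)
  refine ⟨fun g h hgh => galAction_injective (galStable_radicalGroup Γ) (congrArg Subtype.val hgh),
    ?_, hnormal, fun x y => hP.1 (by rw [map_mul, map_mul, mul_comm]), fun x => hP.1 ?_,
    sq_eq_one_of_quotient_sq, P, fun _ _ => rfl, hP,
    flip_bijective_of_bijective sq_eq_one_of_quotient_sq P hP⟩
  · rw [Subgroup.index_eq_card, Nat.card_congr (Equiv.ofBijective P hP),
      card_hom_rootsOfUnity_two sq_eq_one_of_quotient_sq, card_quotient_sq hΓ]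
  · rw [map_pow, map_one]
    exact MonoidHom.ext fun v => by
      rw [MonoidHom.pow_apply, ← map_pow, sq_eq_one_of_quotient_sq, map_one, MonoidHom.one_apply]
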